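/- Let $G$ be an ample groupoid, i.e. a topological groupoid whose space of arrows $G$ and base space $G^0$ are locally compact Hausdorff, which is étale (the range and source maps $r,s:G\to G^0$ are local homeomorphisms), and in which the compact open bisections (sets on which $r$ and $s$ restrict to homeomorphisms onto their images) form a basis of the topology of $G$. Suppose that $G$ is $\sigma$-compact and principal (all isotropy groups are trivial), and that it has dynamic asymptotic dimension at most $d\in\mathbb N$: for every relatively compact open $K\subseteq G$ there are open sets $U_0,\dots,U_d\subseteq G^0$ covering $r(K)\cup s(K)$ such that for each $i$ the set $\{g\in K\mid s(g),r(g)\in U_i\}$ is contained in a relatively compact subgroupoid of $G$. Let $H_n(G)$, $n\ge 0$, be the groupoid homology of Crainic–Moerdijk and Matui, i.e. the $n$-th homology group of the chain complex $(C_c(BG_n,\mathbb Z),\partial_n)_{n\ge 0}$, where $BG_0=G^0$, $BG_n=\{(g_1,\dots,g_n)\in G^n\mid s(g_i)=r(g_{i+1}) \text{ for } 1\le i<n\}$ for $n\ge 1$, $\partial_0=0$, $\partial_n=\sum_{i=0}^n(-1)^i(\epsilon_i)_*$ for $n\ge1$, with face maps $\epsilon_i:BG_n\to BG_{n-1}$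 given for $n\ge 2$ by $\epsilon_0(g_1,\dots,g_n)=(g_2,\dots,g_n)$, $\epsilon_i(g_1,\dots,g_n)=(g_1,\dots,g_ig_{i+1},\dots,g_n)$ for $0<i<n$, $\epsilon_n(g_1,\dots,g_n)=(g_1,\dots,g_{n-1})$, and for $n=1$ by $\epsilon_0=s$, $\epsilon_1=r$; here $f_*(a)(y)=\sum_{f(x)=y}a(x)$ for a local homeomorphism $f$. Then $H_n(G)=0$ for all $n>d$, and the abelian group $H_d(G)$ is torsion-free. -/

import Mathlib

open Topology
open scoped CompactlySupported

/-! ### Push-forward of compactly supported integer functions along local homeomorphisms -/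

namespace IsLocalHomeomorph

theorem finite_fiber_inter_support {Y Z : Type*} [TopologicalSpace Y] [TopologicalSpace Z]
    [T1Space Z] {f : Y → Z} (hf : IsLocalHomeomorph f) (a : C_c(Y, ℤ)) (z : Z) :
    (f ⁻¹' {z} ∩ Function.support a).Finite := by
  have hc : IsCompact (f ⁻¹' {z} ∩ tsupport a) :=
    a.hasCompactSupport.isCompact.inter_left (isClosed_singleton.preimage hf.continuous)
  choose e he hfe using hf
  obtain ⟨t, ht, hcov⟩ := hc.elim_nhds_subcover (fun y => (e y).source)
    (fun y _ => (e y).open_source.mem_nhds (he y))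
  refine t.finite_toSet.subset ?_
  rintro y ⟨hy, hya⟩
  obtain ⟨y', hy't, hy'⟩ := Set.mem_iUnion₂.1 (hcov ⟨hy, subset_tsupport _ hya⟩)
  have h1 : f y' = z := (ht y' hy't).1
  have h2 : f y = z := hy
  have : y = y' := (e y').injOn hy' (he y') (by rw [← hfe y', h1, h2])
  exact this ▸ hy't

/-- The push-forward `f_*(a)(z) = ∑_{y ∈ f⁻¹(z)} a(y)` of compactly supported continuous
integer-valued functions along a local homeomorphism `f` (the sum has finitely many nonzero
terms). -/
noncomputable def pushforward {Y Z : Type*} [TopologicalSpace Y] [TopologicalSpace Z] [T2Space Y]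
    [T2Space Z] {f : Y → Z} (hf : IsLocalHomeomorph f) : C_c(Y, ℤ) →+ C_c(Z, ℤ) where
  toFun a :=
    { toFun := fun z => ∑ᶠ y ∈ f ⁻¹' {z}, a y
      continuous_toFun := by
        apply IsLocallyConstant.continuous
        rw [IsLocallyConstant.iff_eventually_eq]
        intro z
        have hfin := hf.finite_fiber_inter_support a z
        have hK : IsCompact (tsupport a) := a.hasCompactSupport
        choose e he hfe using id hf
        -- disjoint open neighbourhoods of the relevant points of the fibre
        obtain ⟨D, hD, hdis⟩ := hfin.t2_separation
        let U : Y → Set Y := fun y => D y ∩ ((e y).source ∩ a ⁻¹' {a y})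
        have hUo : ∀ y, IsOpen (U y) := fun y => (hD y).2.inter
          ((e y).open_source.inter ((isOpen_discrete _).preimage a.continuous))
        have hUm : ∀ y, y ∈ U y := fun y => ⟨(hD y).1, he y, rfl⟩
        let S : Finset Y := hfin.toFinset
        have hS : ∀ y, y ∈ S ↔ f y = z ∧ a y ≠ 0 := by intro y; simp [S]
        -- the part of the support outside of these neighbourhoods
        have hsupp : IsClosed (Function.support a) := by
          have : Function.support a = a ⁻¹' {0}ᶜ := rfl
          rw [this]
          exact (isClosed_discrete _).preimage a.continuous
        have hC : IsCompact (Function.support a \ ⋃ y ∈ S, U y) := by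
          refine (hK.of_isClosed_subset hsupp (subset_tsupport _)).diff ?_
          exact isOpen_biUnion fun y _ => hUo y
        have hCc : IsClosed (f '' (Function.support a \ ⋃ y ∈ S, U y)) :=
          (hC.image hf.continuous).isClosed
        have hz : z ∉ f '' (Function.support a \ ⋃ y ∈ S, U y) := by
          rintro ⟨y, ⟨hy, hy'⟩, hyz⟩
          exact hy' (Set.mem_iUnion₂.2 ⟨y, (hS y).2 ⟨hyz, hy⟩, hUm y⟩)
        have hW : ∀ᶠ w in 𝓝 z, ∀ y ∈ S, w ∈ f '' (U y) := by
          rw [Filter.eventually_all_finset]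
          intro y hy
          refine (hf.isOpenMap _ (hUo y)).mem_nhds ⟨y, hUm y, ((hS y).1 hy).1⟩
        filter_upwards [hW, hCc.isOpen_compl.mem_nhds hz] with w hw hwC
        choose! g hgU hgw using hw
        have hginj : Set.InjOn g S := by
          intro y hy y' hy' hyy
          by_contra hne
          have h1 := hgU y hy
          have h2 := hgU y' hy'
          rw [← hyy] at h2
          exact Set.disjoint_left.1 (hdis (by simpa [S] using hy) (by simpa [S] using hy') hne)
            h1.1 h2.1
        classical
        have hwsum : ∑ᶠ y ∈ f ⁻¹' {w}, a y = ∑ y ∈ S.image g, a y := by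
          refine finsum_mem_eq_sum_of_inter_support_eq a ?_
          ext y
          simp only [Set.mem_inter_iff, Set.mem_preimage, Set.mem_singleton_iff,
            Function.mem_support, Finset.coe_image, Set.mem_image, SetLike.mem_coe,
            and_congr_left_iff]
          intro hy
          constructor
          · intro hyw
            have : y ∈ ⋃ y ∈ S, U y := by
              by_contra hcon
              exact hwC ⟨y, ⟨hy, hcon⟩, hyw⟩
            obtain ⟨x, hx, hyx⟩ := Set.mem_iUnion₂.1 this
            refine ⟨x, hx, (e x).injOn (hgU x hx).2.1 hyx.2.1 ?_⟩
            rw [← hfe x, hgw x hx, hyw]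
          · rintro ⟨x, hx, rfl⟩
            exact hgw x hx
        have hzsum : ∑ᶠ y ∈ f ⁻¹' {z}, a y = ∑ y ∈ S, a y :=
          finsum_mem_eq_sum_of_inter_support_eq a (by ext y; simp [hS])
        rw [hwsum, hzsum, Finset.sum_image hginj]
        exact Finset.sum_congr rfl fun y hy => (hgU y hy).2.2
      hasCompactSupport' := by
        have hK : IsCompact (tsupport a) := a.hasCompactSupport
        refine HasCompactSupport.intro (hK.image hf.continuous) fun z hz => ?_
        refine finsum_mem_eq_zero_of_forall_eq_zero fun y hy => ?_
        by_contra hne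
        exact hz ⟨y, subset_tsupport _ hne, hy⟩ }
  map_zero' := by
    ext z
    simp
  map_add' a b := by
    ext z
    exact finsum_mem_add_distrib' (hf.finite_fiber_inter_support a z)
      (hf.finite_fiber_inter_support b z)

theorem pushforward_apply {Y Z : Type*} [TopologicalSpace Y] [TopologicalSpace Z] [T2Space Y]
    [T2Space Z] {f : Y → Z} (hf : IsLocalHomeomorph f) (a : C_c(Y, ℤ)) (z : Z) :
    hf.pushforward a z = ∑ᶠ y ∈ f ⁻¹' {z}, a y := rfl

theorem pushforward_congr {Y Z : Type*} [TopologicalSpace Y] [TopologicalSpace Z] [T2Space Y]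
    [T2Space Z] {f g : Y → Z} (hf : IsLocalHomeomorph f) (hg : IsLocalHomeomorph g) (hfg : f = g)
    (a : C_c(Y, ℤ)) : hf.pushforward a = hg.pushforward a := by
  subst hfg
  rfl

theorem pushforward_pushforward {Y Z W : Type*} [TopologicalSpace Y] [TopologicalSpace Z]
    [TopologicalSpace W] [T2Space Y] [T2Space Z] [T2Space W] {f : Y → Z} {g : Z → W}
    (hf : IsLocalHomeomorph f) (hg : IsLocalHomeomorph g) (a : C_c(Y, ℤ)) :
    hg.pushforward (hf.pushforward a) = (hg.comp hf).pushforward a := by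
  classical
  ext w
  have hfin := (hg.comp hf).finite_fiber_inter_support a w
  let S : Finset Y := hfin.toFinset
  have hS : ∀ y, y ∈ S ↔ g (f y) = w ∧ a y ≠ 0 := by intro y; simp [S]
  have hin : ∀ z, g z = w → hf.pushforward a z = ∑ y ∈ S with f y = z, a y := by
    intro z hz
    rw [pushforward_apply]
    refine finsum_mem_eq_sum_of_inter_support_eq a ?_
    ext y
    simp only [Set.mem_inter_iff, Set.mem_preimage, Set.mem_singleton_iff, Function.mem_support,
      Finset.coe_filter, Set.mem_ofPred_eq, hS, and_congr_left_iff]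
    intro hy
    constructor
    · rintro rfl; exact ⟨⟨hz, hy⟩, rfl⟩
    · exact fun h => h.2
  rw [pushforward_apply, pushforward_apply,
    finsum_mem_eq_sum_of_inter_support_eq (t := S) a (by ext y; simp [hS]),
    finsum_mem_eq_sum_of_inter_support_eq (t := S.image f) _ ?_]
  · rw [← Finset.sum_fiberwise_of_maps_to (g := f) (t := S.image f)
      (fun y hy => Finset.mem_image_of_mem f hy)]
    refine Finset.sum_congr rfl fun z hz => hin z ?_
    obtain ⟨y, hy, rfl⟩ := Finset.mem_image.1 hz
    exact ((hS y).1 hy).1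
  · ext z
    simp only [Set.mem_inter_iff, Set.mem_preimage, Set.mem_singleton_iff, Function.mem_support,
      Finset.coe_image, Set.mem_image, SetLike.mem_coe, and_congr_left_iff]
    intro hz
    constructor
    · intro hzw
      rw [hin z hzw] at hz
      obtain ⟨y, hy, -⟩ := Finset.exists_ne_zero_of_sum_ne_zero hz
      rw [Finset.mem_filter] at hy
      exact ⟨y, hy.1, hy.2⟩
    · rintro ⟨y, hy, rfl⟩
      exact ((hS y).1 hy).1

/-- Local homeomorphisms are stable under pullback: if `P` is, via `(q, t)`, the fibred product
of `h : Y → B` and a local homeomorphism `f : E → B`, then `q : P → Y` is a local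
homeomorphism. -/
theorem of_pullback {P Y E B : Type*} [TopologicalSpace P] [TopologicalSpace Y]
    [TopologicalSpace E] [TopologicalSpace B] {q : P → Y} {t : P → E} {h : Y → B} {f : E → B}
    (hf : IsLocalHomeomorph f) (hh : Continuous h)
    (hqt : Topology.IsEmbedding fun p => (q p, t p))
    (hcomm : ∀ p, h (q p) = f (t p)) (hsurj : ∀ y e, h y = f e → ∃ p, q p = y ∧ t p = e) :
    IsLocalHomeomorph q := by
  have hq : Continuous q := continuous_fst.comp hqt.continuous
  have ht : Continuous t := continuous_snd.comp hqt.continuous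
  refine IsLocalHomeomorph.mk _ fun p₀ => ?_
  obtain ⟨e, he, hfe⟩ := hf (t p₀)
  have hex : ∀ y, ∃ p, h y ∈ e.target → q p = y ∧ t p = e.symm (h y) := by
    intro y
    by_cases hy : h y ∈ e.target
    · obtain ⟨p, hp⟩ := hsurj y (e.symm (h y)) (by rw [hfe, e.right_inv hy])
      exact ⟨p, fun _ => hp⟩
    · exact ⟨p₀, fun h => absurd h hy⟩
  choose k hk using hex
  have hmap : ∀ p, t p ∈ e.source → h (q p) ∈ e.target := fun p hp => by
    rw [hcomm, hfe]; exact e.map_source hp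
  exact ⟨{  toFun := q
            invFun := k
            source := t ⁻¹' e.source
            target := h ⁻¹' e.target
            map_source' := fun p hp => hmap p hp
            map_target' := fun y hy => by
              have := (hk y hy).2
              rw [Set.mem_preimage, this]
              exact e.map_target hy
            left_inv' := fun p hp => by
              have hp' := hk (q p) (hmap p hp)
              refine hqt.injective (Prod.ext hp'.1 ?_)
              change t (k (q p)) = t p
              rw [hp'.2, hcomm, hfe, e.left_inv hp]
            right_inv' := fun y hy => (hk y hy).1
            continuousOn_toFun := hq.continuousOn
            continuousOn_invFun := by
              rw [hqt.continuousOn_iff]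
              have : ContinuousOn (fun y => (y, e.symm (h y))) (h ⁻¹' e.target) :=
                continuousOn_id.prodMk (e.continuousOn_symm.comp hh.continuousOn fun y hy => hy)
              exact this.congr fun y hy => Prod.ext (hk y hy).1 (hk y hy).2
            open_source := e.open_source.preimage ht
            open_target := e.open_target.preimage hh }, he, fun _ _ => rfl⟩

end IsLocalHomeomorph

/-! ### Topological groupoids -/

/-- A topological groupoid with base space (space of objects) `X` and space of arrows `G`.
The product `mul g h` is only meaningful if `s g = r h`; the values of the function `mul` on
other pairs are irrelevant, and all axioms (also continuity) only concern composable pairs. -/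
structure TopologicalGroupoid (X G : Type*) [TopologicalSpace X] [TopologicalSpace G] where
  /-- the range of an arrow -/
  r : G → X
  /-- the source of an arrow -/
  s : G → X
  /-- the identity arrow at an object -/
  unit : X → G
  /-- the inverse of an arrow -/
  inv : G → G
  /-- the product of two arrows `g`, `h` with `s g = r h` -/
  mul : G → G → G
  r_unit : ∀ x, r (unit x) = x
  s_unit : ∀ x, s (unit x) = x
  r_inv : ∀ g, r (inv g) = s g
  s_inv : ∀ g, s (inv g) = r g
  r_mul : ∀ g h, s g = r h → r (mul g h) = r g
  s_mul : ∀ g h, s g = r h → s (mul g h) = s h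
  mul_assoc : ∀ g h k, s g = r h → s h = r k → mul (mul g h) k = mul g (mul h k)
  unit_mul : ∀ g, mul (unit (r g)) g = g
  mul_unit : ∀ g, mul g (unit (s g)) = g
  inv_mul : ∀ g, mul (inv g) g = unit (s g)
  mul_inv : ∀ g, mul g (inv g) = unit (r g)
  continuous_r : Continuous r
  continuous_s : Continuous s
  continuous_unit : Continuous unit
  continuous_inv : Continuous inv
  continuousOn_mul : ContinuousOn (fun p : G × G => mul p.1 p.2) {p : G × G | s p.1 = r p.2}

namespace TopologicalGroupoid

variable {X G : Type*} [TopologicalSpace X] [TopologicalSpace G] (𝒢 : TopologicalGroupoid X G)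

theorem inv_inv (g : G) : 𝒢.inv (𝒢.inv g) = g := by
  have h1 : 𝒢.s g = 𝒢.r (𝒢.inv g) := (𝒢.r_inv g).symm
  have h2 : 𝒢.s (𝒢.inv g) = 𝒢.r (𝒢.inv (𝒢.inv g)) := (𝒢.r_inv _).symm
  have h := 𝒢.mul_assoc g (𝒢.inv g) (𝒢.inv (𝒢.inv g)) h1 h2
  rw [𝒢.mul_inv, 𝒢.mul_inv, 𝒢.r_inv, 𝒢.mul_unit] at h
  rwa [← 𝒢.s_inv g, h2, 𝒢.unit_mul] at h

/-- A topological groupoid is étale if its range map (equivalently, since inversion is a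
homeomorphism exchanging `r` and `s`, its source map) is a local homeomorphism. -/
def IsEtale : Prop := IsLocalHomeomorph 𝒢.r

/-- A bisection is a set of arrows on which `r` and `s` restrict to homeomorphisms onto their
images. -/
def IsBisection (B : Set G) : Prop :=
  IsEmbedding (B.domRestrict 𝒢.r) ∧ IsEmbedding (B.domRestrict 𝒢.s)

/-- A topological groupoid is ample if it is étale and the compact open bisections form a basis
of the topology of its space of arrows. -/
structure IsAmple : Prop where
  isEtale : 𝒢.IsEtale
  isTopologicalBasis :
    TopologicalSpace.IsTopologicalBasis {B : Set G | IsCompact B ∧ IsOpen B ∧ 𝒢.IsBisection B}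

/-- A groupoid is principal if all its isotropy groups are trivial. -/
def IsPrincipal : Prop := ∀ g, 𝒢.r g = 𝒢.s g → g = 𝒢.unit (𝒢.s g)

/-- A subgroupoid: a set of arrows closed under inverses and products (it then contains the
identities at the sources and ranges of its elements; it need not contain all identities). -/
def IsSubgroupoid (H : Set G) : Prop :=
  (∀ g ∈ H, 𝒢.inv g ∈ H) ∧ ∀ g ∈ H, ∀ h ∈ H, 𝒢.s g = 𝒢.r h → 𝒢.mul g h ∈ H

/-- The groupoid has dynamic asymptotic dimension at most `d`: for every open relatively compact
set `K` of arrows there are open sets `U₀, …, U_d` of objects covering `r(K) ∪ s(K)` such that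
each `{g ∈ K | s(g), r(g) ∈ Uᵢ}` is contained in a relatively compact subgroupoid. -/
def DynamicAsymptoticDimensionLE (d : ℕ) : Prop :=
  ∀ K : Set G, IsOpen K → IsCompact (closure K) →
    ∃ U : Fin (d + 1) → Set X, (∀ i, IsOpen (U i)) ∧ 𝒢.r '' K ∪ 𝒢.s '' K ⊆ ⋃ i, U i ∧
      ∀ i, ∃ H : Set G, 𝒢.IsSubgroupoid H ∧ IsCompact (closure H) ∧
        {g ∈ K | 𝒢.s g ∈ U i ∧ 𝒢.r g ∈ U i} ⊆ H

/-! ### The classifying space -/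

/-- The space `BG_n` of composable strings `(g_1, …, g_n)` of arrows, `s(g_i) = r(g_{i+1})`. An
element is recorded together with the objects `x_0, …, x_n` it passes through, where
`r(g_i) = x_{i-1}` and `s(g_i) = x_i`; so `BG_0` is the base space, and for `n ≥ 1` the objects
are determined (continuously) by the arrows. The topology is the subspace topology. -/
def BG (n : ℕ) : Type _ :=
  {p : (Fin (n + 1) → X) × (Fin n → G) //
    ∀ i : Fin n, 𝒢.r (p.2 i) = p.1 i.castSucc ∧ 𝒢.s (p.2 i) = p.1 i.succ}

instance (n : ℕ) : TopologicalSpace (𝒢.BG n) := inferInstanceAs (TopologicalSpace (Subtype _))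

instance [T2Space X] [T2Space G] (n : ℕ) : T2Space (𝒢.BG n) :=
  inferInstanceAs (T2Space (Subtype _))

variable {𝒢}

namespace BG

/-- The `i`-th object of a string. -/
def obj {n : ℕ} (p : 𝒢.BG n) (i : Fin (n + 1)) : X := p.1.1 i

/-- The `i`-th arrow of a string (counted from `0`). -/
def arrow {n : ℕ} (p : 𝒢.BG n) (i : Fin n) : G := p.1.2 i

theorem r_arrow {n : ℕ} (p : 𝒢.BG n) (i : Fin n) : 𝒢.r (p.arrow i) = p.obj i.castSucc := (p.2 i).1

theorem s_arrow {n : ℕ} (p : 𝒢.BG n) (i : Fin n) : 𝒢.s (p.arrow i) = p.obj i.succ := (p.2 i).2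

theorem composable {n : ℕ} (p : 𝒢.BG (n + 1)) (i : Fin n) :
    𝒢.s (p.arrow i.castSucc) = 𝒢.r (p.arrow i.succ) := by
  rw [s_arrow, r_arrow, Fin.succ_castSucc]

@[ext]
theorem ext {n : ℕ} {p q : 𝒢.BG n} (h₁ : ∀ i, p.obj i = q.obj i)
    (h₂ : ∀ i, p.arrow i = q.arrow i) : p = q :=
  Subtype.ext (Prod.ext (funext h₁) (funext h₂))

theorem continuous_obj {n : ℕ} (i : Fin (n + 1)) : Continuous fun p : 𝒢.BG n => p.obj i :=
  (continuous_apply i).comp (continuous_fst.comp continuous_subtype_val)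

theorem continuous_arrow {n : ℕ} (i : Fin n) : Continuous fun p : 𝒢.BG n => p.arrow i :=
  (continuous_apply i).comp (continuous_snd.comp continuous_subtype_val)

theorem continuous_of {n : ℕ} {Y : Type*} [TopologicalSpace Y] {f : Y → 𝒢.BG n}
    (h₁ : ∀ i, Continuous fun y => (f y).obj i) (h₂ : ∀ i, Continuous fun y => (f y).arrow i) :
    Continuous f :=
  Continuous.subtype_mk ((continuous_pi h₁).prodMk (continuous_pi h₂)) fun y => (f y).2

end BG

/-- The face map `BG_{n+1} → BG_n` that omits the object `x_i`: for `0 < i < n + 1` it sends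
`(g_1, …, g_{n+1})` to `(g_1, …, g_i g_{i+1}, …, g_{n+1})`, for `i = 0` to `(g_2, …, g_{n+1})`, and
for `i = n + 1` to `(g_1, …, g_n)`. In particular it is `s` for `n = i = 0` and `r` for `n = 0`,
`i = 1`. (Below the arrows are counted from `0`.) -/
def face {n : ℕ} (i : Fin (n + 2)) (p : 𝒢.BG (n + 1)) : 𝒢.BG n :=
  ⟨(fun j => p.obj (i.succAbove j), fun j =>
    if (j : ℕ) + 1 < i then p.arrow j.castSucc
    else if (j : ℕ) + 1 = i then 𝒢.mul (p.arrow j.castSucc) (p.arrow j.succ)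
    else p.arrow j.succ), by
    intro j
    dsimp only
    have h1 : (i.succAbove j.castSucc : Fin (n + 2)) =
        if (j : ℕ) < i then j.castSucc.castSucc else j.succ.castSucc := by
      split_ifs with h
      · exact Fin.succAbove_of_castSucc_lt _ _ h
      · exact Fin.succAbove_of_le_castSucc _ _ (not_lt.1 h)
    have h2 : (i.succAbove j.succ : Fin (n + 2)) =
        if (j : ℕ) + 1 < i then j.castSucc.succ else j.succ.succ := by
      split_ifs with h
      · exact Fin.succAbove_of_castSucc_lt _ _ h
      · exact Fin.succAbove_of_le_castSucc _ _ (not_lt.1 h)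
    rw [h1, h2]
    split_ifs with h3 h4 h4 h5 h5 <;> try omega
    · exact ⟨p.r_arrow _, p.s_arrow _⟩
    · rw [𝒢.r_mul _ _ (p.composable j), 𝒢.s_mul _ _ (p.composable j)]
      exact ⟨p.r_arrow _, p.s_arrow _⟩
    · exact ⟨p.r_arrow _, p.s_arrow _⟩⟩

theorem obj_face {n : ℕ} (i : Fin (n + 2)) (p : 𝒢.BG (n + 1)) (j : Fin (n + 1)) :
    (face i p).obj j = p.obj (i.succAbove j) := rfl

theorem arrow_face {n : ℕ} (i : Fin (n + 2)) (p : 𝒢.BG (n + 1)) (j : Fin n) :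
    (face i p).arrow j =
      if (j : ℕ) + 1 < i then p.arrow j.castSucc
      else if (j : ℕ) + 1 = i then 𝒢.mul (p.arrow j.castSucc) (p.arrow j.succ)
      else p.arrow j.succ := rfl

theorem continuous_face {n : ℕ} (i : Fin (n + 2)) :
    Continuous (face i : 𝒢.BG (n + 1) → 𝒢.BG n) := by
  refine BG.continuous_of (fun j => BG.continuous_obj _) fun j => ?_
  simp only [arrow_face]
  split_ifs
  · exact BG.continuous_arrow _
  · exact 𝒢.continuousOn_mul.comp_continuous
      ((BG.continuous_arrow _).prodMk (BG.continuous_arrow _)) fun p => p.composable j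
  · exact BG.continuous_arrow _

theorem face_face {n : ℕ} {i j : Fin (n + 2)} (hij : i ≤ j) (p : 𝒢.BG (n + 2)) :
    face i (face j.succ p) = face j (face i.castSucc p) := by
  have hij' : (i : ℕ) ≤ j := hij
  ext k
  · simp only [obj_face]
    congr 1
    simp only [Fin.ext_iff, Fin.succAbove, Fin.lt_def]
    split_ifs <;> simp_all <;> omega
  · simp only [arrow_face, Fin.val_castSucc, Fin.val_succ]
    have ha := p.composable k.castSucc
    have hb := p.composable k.succ
    rw [Fin.succ_castSucc] at ha
    split_ifs <;> first | omega | rfl | skip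
    all_goals exact (𝒢.mul_assoc _ _ _ ha hb).symm

theorem isLocalHomeomorph_obj (h : 𝒢.IsEtale) {n : ℕ} (i : Fin (n + 1)) :
    IsLocalHomeomorph fun p : 𝒢.BG n => p.obj i := by
  have hs : IsLocalHomeomorph 𝒢.s := by
    let e : G ≃ₜ G :=
      { toFun := 𝒢.inv
        invFun := 𝒢.inv
        left_inv := 𝒢.inv_inv
        right_inv := 𝒢.inv_inv
        continuous_toFun := 𝒢.continuous_inv
        continuous_invFun := 𝒢.continuous_inv }
    have : 𝒢.s = 𝒢.r ∘ e := funext fun g => (𝒢.r_inv g).symm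
    rw [this]
    exact IsLocalHomeomorph.comp h e.isLocalHomeomorph
  induction n with
  | zero =>
    obtain rfl : i = 0 := Fin.fin_one_eq_zero i
    let e : 𝒢.BG 0 ≃ₜ X :=
      { toFun := fun p => p.obj 0
        invFun := fun x => ⟨(fun _ => x, Fin.elim0), fun i => i.elim0⟩
        left_inv := fun p => BG.ext (fun i => congrArg p.obj (Fin.fin_one_eq_zero i).symm)
          fun i => i.elim0
        right_inv := fun x => rfl
        continuous_toFun := BG.continuous_obj 0
        continuous_invFun := BG.continuous_of (fun _ => continuous_id) fun i => i.elim0 }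
    exact e.isLocalHomeomorph
  | succ n ih =>
    -- forgetting the last object and the last arrow
    let q : 𝒢.BG (n + 1) → 𝒢.BG n := fun p =>
      ⟨(fun i => p.obj i.castSucc, fun i => p.arrow i.castSucc),
        fun i => ⟨p.r_arrow _, p.s_arrow _⟩⟩
    let t : 𝒢.BG (n + 1) → G := fun p => p.arrow (Fin.last n)
    have hq : Continuous q :=
      BG.continuous_of (fun i => BG.continuous_obj _) fun i => BG.continuous_arrow _
    have ht : Continuous t := BG.continuous_arrow _
    have hcomm : ∀ p, (q p).obj (Fin.last n) = 𝒢.r (t p) := fun p => (p.r_arrow _).symm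
    -- adding an arrow at the end
    let k : {y : 𝒢.BG n × G // y.1.obj (Fin.last n) = 𝒢.r y.2} → 𝒢.BG (n + 1) := fun y =>
      ⟨(Fin.snoc (α := fun _ => X) y.1.1.obj (𝒢.s y.1.2),
        Fin.snoc (α := fun _ => G) y.1.1.arrow y.1.2), fun i => by
          induction i using Fin.lastCases with
          | last => simp [y.2]
          | cast i =>
            dsimp only
            rw [Fin.snoc_castSucc, Fin.snoc_castSucc, Fin.succ_castSucc, Fin.snoc_castSucc]
            exact ⟨y.1.1.r_arrow i, y.1.1.s_arrow i⟩⟩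
    have hk : Continuous k := by
      refine BG.continuous_of (fun i => ?_) fun i => ?_
      · induction i using Fin.lastCases with
        | last =>
          have : (fun y => (k y).obj (Fin.last (n + 1))) = fun y => 𝒢.s y.1.2 := by
            funext y; exact Fin.snoc_last (α := fun _ => X) _ _
          rw [this]
          exact 𝒢.continuous_s.comp (continuous_snd.comp continuous_subtype_val)
        | cast i =>
          have : (fun y => (k y).obj i.castSucc) = fun y => y.1.1.obj i := by
            funext y; exact Fin.snoc_castSucc (α := fun _ => X) _ _ _
          rw [this]
          exact (BG.continuous_obj i).comp (continuous_fst.comp continuous_subtype_val)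
      · induction i using Fin.lastCases with
        | last =>
          have : (fun y => (k y).arrow (Fin.last n)) = fun y => y.1.2 := by
            funext y; exact Fin.snoc_last (α := fun _ => G) _ _
          rw [this]
          exact continuous_snd.comp continuous_subtype_val
        | cast i =>
          have : (fun y => (k y).arrow i.castSucc) = fun y => y.1.1.arrow i := by
            funext y; exact Fin.snoc_castSucc (α := fun _ => G) _ _ _
          rw [this]
          exact (BG.continuous_arrow i).comp (continuous_fst.comp continuous_subtype_val)
    have hqk : ∀ y, q (k y) = y.1.1 := fun y =>
      BG.ext (fun i => Fin.snoc_castSucc (α := fun _ => X) _ _ _)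
        fun i => Fin.snoc_castSucc (α := fun _ => G) _ _ _
    have htk : ∀ y, t (k y) = y.1.2 := fun y => Fin.snoc_last (α := fun _ => G) _ _
    have hkq : ∀ p, k ⟨(q p, t p), hcomm p⟩ = p := by
      intro p
      refine BG.ext (fun i => ?_) fun i => ?_
      · induction i using Fin.lastCases with
        | last => exact (Fin.snoc_last (α := fun _ => X) _ _).trans (p.s_arrow _)
        | cast i => exact Fin.snoc_castSucc (α := fun _ => X) _ _ _
      · induction i using Fin.lastCases with
        | last => exact Fin.snoc_last (α := fun _ => G) _ _
        | cast i => exact Fin.snoc_castSucc (α := fun _ => G) _ _ _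
    let e : 𝒢.BG (n + 1) ≃ₜ {y : 𝒢.BG n × G // y.1.obj (Fin.last n) = 𝒢.r y.2} :=
      { toFun := fun p => ⟨(q p, t p), hcomm p⟩
        invFun := k
        left_inv := hkq
        right_inv := fun y => Subtype.ext (Prod.ext (hqk y) (htk y))
        continuous_toFun := (hq.prodMk ht).subtype_mk _
        continuous_invFun := hk }
    have hemb : IsEmbedding fun p => (q p, t p) := IsEmbedding.subtypeVal.comp e.isEmbedding
    have hqt : IsLocalHomeomorph q :=
      IsLocalHomeomorph.of_pullback (h := fun p => p.obj (Fin.last n)) (f := 𝒢.r) (t := t) h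
        (BG.continuous_obj _) hemb hcomm fun y g hyg => ⟨k ⟨(y, g), hyg⟩, hqk _, htk _⟩
    have htt : IsLocalHomeomorph t :=
      IsLocalHomeomorph.of_pullback (h := 𝒢.r) (f := fun p : 𝒢.BG n => p.obj (Fin.last n))
        (t := q) (ih _) 𝒢.continuous_r ((Homeomorph.prodComm _ _).isEmbedding.comp hemb)
        (fun p => (hcomm p).symm) fun g y hyg => ⟨k ⟨(y, g), hyg.symm⟩, htk _, hqk _⟩
    induction i using Fin.lastCases with
    | last =>
      have : (fun p : 𝒢.BG (n + 1) => p.obj (Fin.last (n + 1))) = 𝒢.s ∘ t :=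
        funext fun p => (p.s_arrow (Fin.last n)).symm
      rw [this]
      exact hs.comp htt
    | cast i => exact (ih i).comp hqt

theorem isLocalHomeomorph_face (h : 𝒢.IsEtale) {n : ℕ} (i : Fin (n + 2)) :
    IsLocalHomeomorph (face i : 𝒢.BG (n + 1) → 𝒢.BG n) :=
  IsLocalHomeomorph.of_comp (g := fun p : 𝒢.BG n => p.obj 0)
    (isLocalHomeomorph_obj h (i.succAbove 0)) (isLocalHomeomorph_obj h 0) (continuous_face i)

/-! ### Groupoid homology -/

section Homology

variable [T2Space X] [T2Space G] (𝒢)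

/-- The boundary map `∂ = ∑ᵢ (-1)ⁱ (dᵢ)_* : C_c(BG_{n+1}, ℤ) → C_c(BG_n, ℤ)`, where the `dᵢ` are
the face maps. -/
noncomputable def boundary (h : 𝒢.IsEtale) (n : ℕ) : C_c(𝒢.BG (n + 1), ℤ) →+ C_c(𝒢.BG n, ℤ) :=
  ∑ i : Fin (n + 2), (-1 : ℤ) ^ (i : ℕ) • (isLocalHomeomorph_face h i).pushforward

theorem boundary_apply (h : 𝒢.IsEtale) (n : ℕ) (a : C_c(𝒢.BG (n + 1), ℤ)) :
    𝒢.boundary h n a =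
      ∑ i : Fin (n + 2), (-1 : ℤ) ^ (i : ℕ) • (isLocalHomeomorph_face h i).pushforward a := by
  simp [boundary, AddMonoidHom.finsetSum_apply]

theorem boundary_boundary (h : 𝒢.IsEtale) (n : ℕ) (a : C_c(𝒢.BG (n + 2), ℤ)) :
    𝒢.boundary h n (𝒢.boundary h (n + 1) a) = 0 := by
  simp only [boundary_apply, map_sum, map_zsmul, IsLocalHomeomorph.pushforward_pushforward,
    Finset.smul_sum, smul_smul, ← pow_add]
  rw [Finset.sum_comm, ← Finset.sum_product', Finset.univ_product_univ]
  let S : Finset (Fin (n + 2) × Fin (n + 3)) := {ij | (ij.2 : ℕ) ≤ (ij.1 : ℕ)}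
  have hS : ∀ ij, ij ∈ S ↔ (ij.2 : ℕ) ≤ (ij.1 : ℕ) := fun ij => by simp [S]
  refine Eq.trans (Finset.sum_add_sum_compl S _).symm ?_
  rw [← eq_neg_iff_add_eq_zero, ← Finset.sum_neg_distrib]
  -- the terms `(i, j)` with `j ≤ i` cancel against the terms `(j, i + 1)`
  refine Finset.sum_bij (fun ij hij => (ij.2.castLT (((hS ij).1 hij).trans_lt ij.1.2),
    ij.1.succ)) ?_ ?_ ?_ ?_
  · rintro ⟨i, j⟩ hij
    rw [hS] at hij
    rw [Finset.mem_compl, hS]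
    simp only [Fin.val_succ, Fin.val_castLT] at hij ⊢
    omega
  · rintro ⟨i, j⟩ hij ⟨i', j'⟩ hij' h
    simp only [Prod.mk.injEq, Fin.ext_iff, Fin.val_succ, Fin.val_castLT] at h ⊢
    omega
  · rintro ⟨i, j⟩ hij
    rw [Finset.mem_compl, hS] at hij
    dsimp only at hij
    refine ⟨(⟨(j : ℕ) - 1, by omega⟩, i.castSucc), (hS _).2 ?_, ?_⟩
    · exact Nat.le_sub_one_of_lt (not_le.1 hij)
    · refine Prod.ext (Fin.ext rfl) (Fin.ext ?_)
      exact Nat.sub_add_cancel (Nat.one_le_of_lt (not_le.1 hij))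
  · rintro ⟨i, j⟩ hij
    have hij' := (hS _).1 hij
    have hp : ((isLocalHomeomorph_face h i).comp (isLocalHomeomorph_face h j)).pushforward a =
        ((isLocalHomeomorph_face h (j.castLT (hij'.trans_lt i.2))).comp
          (isLocalHomeomorph_face h i.succ)).pushforward a := by
      refine IsLocalHomeomorph.pushforward_congr _ _ (funext fun p => ?_) a
      exact (face_face (𝒢 := 𝒢) (i := j.castLT (hij'.trans_lt i.2)) (j := i) hij' p).symm
    dsimp only
    rw [hp, ← neg_smul]
    congr 1
    rw [Fin.val_succ, Fin.val_castLT]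
    ring

open CategoryTheory in
/-- The chain complex `⋯ → C_c(BG_2, ℤ) → C_c(BG_1, ℤ) → C_c(BG_0, ℤ) → 0` of an étale
groupoid. -/
noncomputable def chainComplex (h : 𝒢.IsEtale) : ChainComplex AddCommGrpCat ℕ :=
  ChainComplex.of (fun n => AddCommGrpCat.of C_c(𝒢.BG n, ℤ))
    (fun n => AddCommGrpCat.ofHom (𝒢.boundary h n)) fun n => by
      refine AddCommGrpCat.hom_ext (AddMonoidHom.ext fun a => ?_)
      exact 𝒢.boundary_boundary h n a

/-- The homology groups `H_n(G)` of an étale groupoid (with Hausdorff spaces of objects and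
arrows). -/
noncomputable def homology (h : 𝒢.IsEtale) (n : ℕ) : AddCommGrpCat :=
  (𝒢.chainComplex h).homology n

end Homology

end TopologicalGroupoid

/-!
Since the groupoid is principal, `BG_n` is the set of `(n + 1)`-tuples `(x_0, …, x_n)` of objects in
a common orbit, and operators on `C_c(BG_n, ℤ)` can be described by kernels that send such a tuple
to a formal combination of tuples (`realized`, `admissible`). Identities between operators are then
verified tuple by tuple (`realized_eq_zero`), in the ordered chain complex of the set of objects.

Let `K` be a compact set of arrows that contains all arrows between objects of the strings in the
supports of the chains at hand. Dynamic asymptotic dimension at most `d` gives a locally constant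
colouring of the objects by `d + 1` colours for which the monochromatic arrows in (a compact open
enlargement of) `K` generate a relatively compact subgroupoid. That subgroupoid is compact and open
(`exists_isSubgroupoid`), so it has a fundamental domain, and each object can be moved continuously
along an arrow to the representative of its orbit (`exists_rangeSection_of_isSubgroupoid`). After
this collapse, two objects of a string with arrows in `K` that have the same colour coincide
(`exists_rangeSection_of_dynamicAsymptoticDimensionLE`).

Collapsing a tuple and sorting it by colour, with the sign of the sorting permutation and with `0`
as value if a colour occurs twice, is therefore a chain map `ρ` on the tuples with arrows in `K`,
and it is chain homotopic to the identity through an explicit prism operator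
(`Compatible.bdL_sort`, `Compatible.bdL_prism_add`). As there are only `d + 1` colours, `ρ` vanishes
in degrees above `d`. So a cycle `a` of degree `n > d` is homologous to `ρ a = 0`. If `a` is a cycle
of degree `d` with `m a = ∂ b` and `m ≠ 0`, then `m (ρ a) = ρ (∂ b) = ∂ (ρ b) = 0`, hence `ρ a = 0`
because integer-valued functions are torsion-free, and again `a` is homologous to `ρ a = 0`.
-/

/-! ### Ordered chains on a coloured set of vertices -/

namespace OrderedChain

open Finsupp

variable {X ι : Type*}

/-- Prepending the vertex `y`, extended linearly. Chains are formal integral combinations of lists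
of vertices; a simplex of dimension `n` is a list of length `n + 1`, and the empty list spans the
augmentation. -/
noncomputable def cone (y : X) : (List X →₀ ℤ) →ₗ[ℤ] (List X →₀ ℤ) :=
  linearCombination ℤ fun l => single (y :: l) 1

@[simp]
theorem cone_single (y : X) (l : List X) : cone y (single l 1) = single (y :: l) 1 := by
  simp [cone]

/-- The augmented boundary of a simplex; the recursion expresses that `cone y` contracts the
augmented complex. -/
noncomputable def bd : List X → (List X →₀ ℤ)
  | [] => 0
  | y :: l => single l 1 - cone y (bd l)

/-- The linear extension of `bd`. -/
noncomputable def bdL : (List X →₀ ℤ) →ₗ[ℤ] (List X →₀ ℤ) := linearCombination ℤ bd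

@[simp]
theorem bdL_single (l : List X) : bdL (single l 1) = bd l := by simp [bdL]

theorem bdL_cone (y : X) (u : List X →₀ ℤ) : bdL (cone y u) = u - cone y (bdL u) := by
  suffices bdL ∘ₗ cone y = LinearMap.id - cone y ∘ₗ bdL from LinearMap.congr_fun this u
  refine Finsupp.lhom_ext' fun l => LinearMap.ext_ring ?_
  simp [bd]

theorem bd_ofFn {n : ℕ} (x : Fin (n + 1) → X) :
    bd (List.ofFn x) =
      ∑ i : Fin (n + 1), (-1 : ℤ) ^ (i : ℕ) • single (List.ofFn (x ∘ i.succAbove)) 1 := by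
  induction n with
  | zero => simp [bd]
  | succ n ih =>
    rw [List.ofFn_succ, bd, ih (fun i => x i.succ), Fin.sum_univ_succ (n := n + 1), map_sum,
      sub_eq_add_neg, ← Finset.sum_neg_distrib]
    congr 1
    · simp [Function.comp_def]
    · refine Finset.sum_congr rfl fun i _ => ?_
      rw [map_smul, cone_single, Fin.val_succ, pow_succ, mul_neg_one, neg_smul,
        List.ofFn_succ (f := x ∘ i.succ.succAbove)]
      simp [Function.comp_def]

/-- The collapse `f` identifies any two vertices of the simplex whose images have the same colour. -/
def Compatible (c : X → ι) (f : X → X) (l : List X) : Prop :=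
  ∀ y ∈ l, ∀ z ∈ l, c (f y) = c (f z) → f y = f z

theorem Compatible.tail {c : X → ι} {f : X → X} {y : X} {l : List X}
    (h : Compatible c f (y :: l)) : Compatible c f l :=
  fun a ha b hb => h a (by simp [ha]) b (by simp [hb])

variable [LinearOrder ι] (c : X → ι)

/-- Insertion of `m` into a list that is sorted by colour, with the sign of the permutation that
moves `m` from the front to its place, and `0` if the colour of `m` already occurs. On oriented
chains this is the exterior product with `m`. -/
noncomputable def ins (m : X) : List X → (List X →₀ ℤ)
  | [] => single [m] 1
  | t :: l =>
    if c m < c t then single (m :: t :: l) 1 else if c t < c m then -cone t (ins m l) else 0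

/-- The linear extension of `ins`. -/
noncomputable def insL (m : X) : (List X →₀ ℤ) →ₗ[ℤ] (List X →₀ ℤ) := linearCombination ℤ (ins c m)

@[simp]
theorem insL_single (m : X) (l : List X) : insL c m (single l 1) = ins c m l := by simp [insL]

theorem ins_of_lt {m : X} {l : List X} (h : ∀ t ∈ l, c m < c t) :
    ins c m l = single (m :: l) 1 := by
  cases l with
  | nil => rfl
  | cons t l => rw [ins, if_pos (h t (by simp))]

theorem insL_cone_of_lt {m t : X} (h : c m < c t) (u : List X →₀ ℤ) :
    insL c m (cone t u) = cone m (cone t u) := by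
  suffices insL c m ∘ₗ cone t = cone m ∘ₗ cone t from LinearMap.congr_fun this u
  refine Finsupp.lhom_ext' fun l => LinearMap.ext_ring ?_
  simp [ins, h]

theorem insL_cone_of_gt {m t : X} (h : c t < c m) (u : List X →₀ ℤ) :
    insL c m (cone t u) = -cone t (insL c m u) := by
  suffices insL c m ∘ₗ cone t = -(cone t ∘ₗ insL c m) from LinearMap.congr_fun this u
  refine Finsupp.lhom_ext' fun l => LinearMap.ext_ring ?_
  simp [ins, h, h.le.not_gt]

theorem insL_cone_of_eq {m t : X} (h : c t = c m) (u : List X →₀ ℤ) :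
    insL c m (cone t u) = 0 := by
  suffices insL c m ∘ₗ cone t = 0 from LinearMap.congr_fun this u
  refine Finsupp.lhom_ext' fun l => LinearMap.ext_ring ?_
  simp [ins, h]

/-- Insertion of `m` contracts the complex of chains that are strictly sorted by colour, if a vertex
with the colour of `m` equals `m`. -/
theorem bdL_ins {m : X} {l : List X} (hl : l.Pairwise fun s t => c s < c t)
    (hm : ∀ t ∈ l, c t = c m → t = m) :
    bdL (ins c m l) = single l 1 - insL c m (bd l) := by
  induction l with
  | nil => simp [ins, bd]
  | cons t l ih =>
    rw [List.pairwise_cons] at hl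
    rw [bd, map_sub, insL_single]
    rcases lt_trichotomy (c m) (c t) with h | h | h
    · rw [ins, if_pos h, bdL_single, bd, bd, insL_cone_of_lt c h,
        ins_of_lt c fun s hs => h.trans (hl.1 s hs), map_sub, cone_single]
    · obtain rfl : t = m := hm t (by simp) h.symm
      rw [ins, if_neg (lt_irrefl _), if_neg (lt_irrefl _), insL_cone_of_eq c rfl,
        ins_of_lt c hl.1]
      simp
    · rw [ins, if_neg h.le.not_gt, if_pos h, map_neg, bdL_cone, insL_cone_of_gt c h,
        ih hl.2 fun s hs => hm s (by simp [hs]), map_sub, cone_single]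
      abel

theorem ins_mem_supported {m : X} {l : List X} (hl : l.Pairwise fun s t => c s < c t) :
    ins c m l ∈ supported ℤ ℤ {k : List X | k.Pairwise (fun s t => c s < c t) ∧
      k.length = l.length + 1 ∧ ∀ t ∈ k, t = m ∨ t ∈ l} := by
  induction l with
  | nil => exact single_mem_supported ℤ _ (by simp)
  | cons t l ih =>
    have hl' := List.pairwise_cons.1 hl
    rw [ins]
    split_ifs with h1 h2
    · refine single_mem_supported ℤ _ ⟨?_, by simp, by simp⟩
      refine List.pairwise_cons.2 ⟨fun s hs => ?_, hl⟩
      rcases List.mem_cons.1 hs with rfl | hs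
      · exact h1
      · exact h1.trans (hl'.1 s hs)
    · refine neg_mem ?_
      suffices h : supported ℤ ℤ {k : List X | k.Pairwise (fun s t => c s < c t) ∧
          k.length = l.length + 1 ∧ ∀ t ∈ k, t = m ∨ t ∈ l} ≤ (supported ℤ ℤ
          {k : List X | k.Pairwise (fun s t => c s < c t) ∧
          k.length = (t :: l).length + 1 ∧ ∀ s ∈ k, s = m ∨ s ∈ t :: l}).comap (cone t) from
        h (ih hl'.2)
      rw [supported_eq_span_single, Submodule.span_le]
      rintro _ ⟨k, ⟨hk1, hk2, hk3⟩, rfl⟩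
      refine Submodule.mem_comap.2 ?_
      rw [cone_single]
      refine single_mem_supported ℤ _ ⟨List.pairwise_cons.2 ⟨fun s hs => ?_, hk1⟩,
        by simp [hk2], fun s hs => ?_⟩
      · rcases hk3 s hs with rfl | hs
        · exact h2
        · exact hl'.1 s hs
      · rcases List.mem_cons.1 hs with rfl | hs
        · simp
        · rcases hk3 s hs with h | h <;> simp [h]
    · exact zero_mem _

variable (f : X → X)

/-- The simplex with vertices `f y`, sorted by colour and with the sign of the sorting
permutation, or `0` if two of these vertices have the same colour. -/
noncomputable def sort : List X → (List X →₀ ℤ)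
  | [] => single [] 1
  | y :: l => insL c (f y) (sort l)

/-- The linear extension of `sort`. -/
noncomputable def sortL : (List X →₀ ℤ) →ₗ[ℤ] (List X →₀ ℤ) := linearCombination ℤ (sort c f)

@[simp]
theorem sortL_single (l : List X) : sortL c f (single l 1) = sort c f l := by simp [sortL]

theorem sortL_cone (y : X) (u : List X →₀ ℤ) :
    sortL c f (cone y u) = insL c (f y) (sortL c f u) := by
  suffices sortL c f ∘ₗ cone y = insL c (f y) ∘ₗ sortL c f from LinearMap.congr_fun this u
  refine Finsupp.lhom_ext' fun l => LinearMap.ext_ring ?_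
  simp [sort]

theorem sort_mem_supported (l : List X) :
    sort c f l ∈ supported ℤ ℤ {k : List X | k.Pairwise (fun s t => c s < c t) ∧
      k.length = l.length ∧ ∀ t ∈ k, ∃ y ∈ l, t = f y} := by
  induction l with
  | nil => exact single_mem_supported ℤ _ (by simp)
  | cons y l ih =>
    rw [sort]
    suffices h : supported ℤ ℤ {k : List X | k.Pairwise (fun s t => c s < c t) ∧
        k.length = l.length ∧ ∀ t ∈ k, ∃ y ∈ l, t = f y} ≤ (supported ℤ ℤ
        {k : List X | k.Pairwise (fun s t => c s < c t) ∧
        k.length = (y :: l).length ∧ ∀ t ∈ k, ∃ z ∈ y :: l, t = f z}).comap (insL c (f y)) from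
      h ih
    rw [supported_eq_span_single, Submodule.span_le]
    rintro _ ⟨k, ⟨hk1, hk2, hk3⟩, rfl⟩
    refine Submodule.mem_comap.2 ?_
    rw [insL_single]
    refine supported_mono ?_ (ins_mem_supported c hk1)
    rintro k' ⟨h1, h2, h3⟩
    refine ⟨h1, by simp [h2, hk2], fun t ht => ?_⟩
    rcases h3 t ht with rfl | ht
    · exact ⟨y, by simp, rfl⟩
    · obtain ⟨z, hz, rfl⟩ := hk3 t ht
      exact ⟨z, by simp [hz], rfl⟩

/-- A simplex with more vertices than there are colours is sorted to zero. -/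
theorem sort_eq_zero [Fintype ι] {l : List X} (hl : Fintype.card ι < l.length) :
    sort c f l = 0 := by
  have h := sort_mem_supported c f l
  rw [mem_supported] at h
  rw [← support_eq_empty, Finset.eq_empty_iff_forall_notMem]
  intro k hk
  obtain ⟨h1, h2, -⟩ := h hk
  have h3 : (k.map c).Nodup := List.pairwise_map.2 (h1.imp fun h => h.ne)
  have := h3.length_le_card
  rw [List.length_map, h2] at this
  omega

variable {c f}

theorem Compatible.bdL_insL_sort {y : X} {l : List X} (h : Compatible c f (y :: l)) :
    bdL (insL c (f y) (sort c f l)) = sort c f l - insL c (f y) (bdL (sort c f l)) := by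
  suffices H : supported ℤ ℤ {k : List X | k.Pairwise (fun s t => c s < c t) ∧
      k.length = l.length ∧ ∀ t ∈ k, ∃ y ∈ l, t = f y} ≤
      LinearMap.eqLocus (bdL ∘ₗ insL c (f y)) (LinearMap.id - insL c (f y) ∘ₗ bdL) from
    LinearMap.mem_eqLocus.1 (H (sort_mem_supported c f l))
  rw [supported_eq_span_single, Submodule.span_le]
  rintro _ ⟨k, ⟨hk1, -, hk3⟩, rfl⟩
  refine LinearMap.mem_eqLocus.2 ?_
  simp only [LinearMap.comp_apply, LinearMap.sub_apply, LinearMap.id_apply, insL_single,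
    bdL_single]
  refine bdL_ins c hk1 fun t ht htm => ?_
  obtain ⟨z, hz, rfl⟩ := hk3 t ht
  exact h z (by simp [hz]) y (by simp) htm

theorem Compatible.bdL_sort {l : List X} (h : Compatible c f l) :
    bdL (sort c f l) = sortL c f (bd l) := by
  induction l with
  | nil => simp [sort, bd]
  | cons y l ih =>
    rw [sort, h.bdL_insL_sort, ih h.tail, bd, map_sub, sortL_single, sortL_cone]

variable (c f)

/-- The chain homotopy between the identity and `sort c f`. Here `cone y` and `insL c (f y)` are two
contractions, so that `cone y ∘ (cone y - insL c (f y))` is a homotopy between them, and the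
homotopies of the single vertices are combined along the list. -/
noncomputable def prism : List X → (List X →₀ ℤ)
  | [] => 0
  | y :: l => cone y (cone y (sort c f l) - insL c (f y) (sort c f l)) - cone y (prism l)

/-- The linear extension of `prism`. -/
noncomputable def prismL : (List X →₀ ℤ) →ₗ[ℤ] (List X →₀ ℤ) := linearCombination ℤ (prism c f)

@[simp]
theorem prismL_single (l : List X) : prismL c f (single l 1) = prism c f l := by simp [prismL]

theorem prismL_cone (y : X) (u : List X →₀ ℤ) :
    prismL c f (cone y u) =
      cone y (cone y (sortL c f u) - insL c (f y) (sortL c f u)) - cone y (prismL c f u) := by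
  suffices prismL c f ∘ₗ cone y =
      cone y ∘ₗ (cone y ∘ₗ sortL c f - insL c (f y) ∘ₗ sortL c f) - cone y ∘ₗ prismL c f from
    LinearMap.congr_fun this u
  refine Finsupp.lhom_ext' fun l => LinearMap.ext_ring ?_
  simp [prism]

variable {c f}

theorem Compatible.bdL_prism_add {l : List X} (h : Compatible c f l) :
    bdL (prism c f l) + prismL c f (bd l) = single l 1 - sort c f l := by
  induction l with
  | nil => simp [prism, bd, sort]
  | cons y l ih =>
    have h1 := ih h.tail
    have h2 := h.tail.bdL_sort
    rw [prism, map_sub, bdL_cone, bdL_cone, map_sub, bdL_cone, h.bdL_insL_sort, bd,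
      map_sub (prismL c f), prismL_single, prismL_cone, ← h2, sort, eq_sub_iff_add_eq.2 h1,
      ← cone_single]
    simp only [map_sub]
    abel

end OrderedChain

/-! ### Strings with prescribed vertices -/

namespace TopologicalGroupoid

variable {X G : Type*} [TopologicalSpace X] [TopologicalSpace G] {𝒢 : TopologicalGroupoid X G}

theorem IsPrincipal.eq_of_r_eq_of_s_eq (hp : 𝒢.IsPrincipal) {g h : G} (hr : 𝒢.r g = 𝒢.r h)
    (hs : 𝒢.s g = 𝒢.s h) : g = h := by
  have h1 : 𝒢.s (𝒢.inv g) = 𝒢.r h := by rw [𝒢.s_inv, hr]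
  have h2 := hp (𝒢.mul (𝒢.inv g) h) (by
    rw [𝒢.r_mul _ _ h1, 𝒢.s_mul _ _ h1, 𝒢.r_inv, hs])
  rw [𝒢.s_mul _ _ h1, ← hs] at h2
  have h3 := 𝒢.mul_assoc g (𝒢.inv g) h (𝒢.r_inv g).symm h1
  rw [h2, 𝒢.mul_unit, 𝒢.mul_inv, hr, 𝒢.unit_mul] at h3
  exact h3.symm

theorem IsEtale.isLocalHomeomorph_s (he : 𝒢.IsEtale) : IsLocalHomeomorph 𝒢.s := by
  let e : G ≃ₜ G :=
    { toFun := 𝒢.inv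
      invFun := 𝒢.inv
      left_inv := 𝒢.inv_inv
      right_inv := 𝒢.inv_inv
      continuous_toFun := 𝒢.continuous_inv
      continuous_invFun := 𝒢.continuous_inv }
  have : 𝒢.s = 𝒢.r ∘ e := funext fun g => (𝒢.r_inv g).symm
  rw [this]
  exact IsLocalHomeomorph.comp he e.isLocalHomeomorph

namespace BG

/-- The list of objects that a string passes through. -/
def objs {n : ℕ} (p : 𝒢.BG n) : List X := List.ofFn p.obj

theorem ext_of_isPrincipal (hp : 𝒢.IsPrincipal) {n : ℕ} {p q : 𝒢.BG n}
    (h : ∀ i, p.obj i = q.obj i) : p = q :=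
  BG.ext h fun i => hp.eq_of_r_eq_of_s_eq (by rw [r_arrow, r_arrow, h])
    (by rw [s_arrow, s_arrow, h])

/-- In a principal groupoid a string is determined by its objects, so chains on `BG_n` may be
compared through lists of objects. -/
theorem objs_injective (hp : 𝒢.IsPrincipal) (n : ℕ) :
    Function.Injective (objs : 𝒢.BG n → List X) := fun _ _ h =>
  ext_of_isPrincipal hp fun i => congrFun (List.ofFn_injective h) i

theorem bd_objs {n : ℕ} (p : 𝒢.BG (n + 1)) : OrderedChain.bd p.objs =
    ∑ i : Fin (n + 2), (-1 : ℤ) ^ (i : ℕ) • Finsupp.single (face i p).objs 1 :=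
  OrderedChain.bd_ofFn p.obj

end BG

variable (𝒢) in
/-- A continuous lift along `r` of the map `π` to the base space: for every `y` an arrow with range
`π y`. It encodes a vertex `s (arrow y)` in the orbit of `π y` that varies continuously. -/
structure RangeSection {Y : Type*} [TopologicalSpace Y] (π : Y → X) where
  /-- The arrow with range `π y`. -/
  arrow : Y → G
  continuous_arrow : Continuous arrow
  r_arrow : ∀ y, 𝒢.r (arrow y) = π y

namespace RangeSection

variable {Y : Type*} [TopologicalSpace Y] {π : Y → X}

/-- The source of the arrow over `y`. -/
def vertex (v : 𝒢.RangeSection π) (y : Y) : X := 𝒢.s (v.arrow y)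

theorem isLocalHomeomorph_vertex (he : 𝒢.IsEtale) (hπ : IsLocalHomeomorph π)
    (v : 𝒢.RangeSection π) : IsLocalHomeomorph v.vertex := by
  have h : IsLocalHomeomorph v.arrow :=
    IsLocalHomeomorph.of_comp (g := 𝒢.r) (f := v.arrow)
      (by rwa [show 𝒢.r ∘ v.arrow = π from funext v.r_arrow]) he v.continuous_arrow
  exact he.isLocalHomeomorph_s.comp h

theorem continuous_vertex (v : 𝒢.RangeSection π) : Continuous v.vertex :=
  𝒢.continuous_s.comp v.continuous_arrow

/-- Multiplication by a global section `γ` of `r`: the vertex `x` is moved to `γ.vertex x`. -/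
def trans (v : 𝒢.RangeSection π) (γ : 𝒢.RangeSection (id : X → X)) : 𝒢.RangeSection π where
  arrow y := 𝒢.mul (v.arrow y) (γ.arrow (v.vertex y))
  continuous_arrow := 𝒢.continuousOn_mul.comp_continuous
    (v.continuous_arrow.prodMk (γ.continuous_arrow.comp v.continuous_vertex))
    fun y => (γ.r_arrow (v.vertex y)).symm
  r_arrow y := by rw [𝒢.r_mul _ _ (γ.r_arrow (v.vertex y)).symm, v.r_arrow]

theorem vertex_trans (v : 𝒢.RangeSection π) (γ : 𝒢.RangeSection (id : X → X)) (y : Y) :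
    (v.trans γ).vertex y = γ.vertex (v.vertex y) :=
  𝒢.s_mul _ _ (γ.r_arrow (v.vertex y)).symm

theorem s_inv_arrow (v w : 𝒢.RangeSection π) (y : Y) :
    𝒢.s (𝒢.inv (v.arrow y)) = 𝒢.r (w.arrow y) := by
  rw [𝒢.s_inv, v.r_arrow, w.r_arrow]

/-- The arrow with range `v.vertex y` and source `w.vertex y`. -/
def between (v w : 𝒢.RangeSection π) (y : Y) : G := 𝒢.mul (𝒢.inv (v.arrow y)) (w.arrow y)

theorem continuous_between (v w : 𝒢.RangeSection π) : Continuous (v.between w) :=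
  𝒢.continuousOn_mul.comp_continuous
    ((𝒢.continuous_inv.comp v.continuous_arrow).prodMk w.continuous_arrow) (s_inv_arrow v w)

theorem r_between (v w : 𝒢.RangeSection π) (y : Y) : 𝒢.r (v.between w y) = v.vertex y := by
  rw [between, 𝒢.r_mul _ _ (s_inv_arrow v w y), 𝒢.r_inv, vertex]

theorem s_between (v w : 𝒢.RangeSection π) (y : Y) : 𝒢.s (v.between w y) = w.vertex y := by
  rw [between, 𝒢.s_mul _ _ (s_inv_arrow v w y), vertex]

/-- The string that passes through the vertices of `L 0, …, L m`. -/
def string {m : ℕ} (L : Fin (m + 1) → 𝒢.RangeSection π) (y : Y) : 𝒢.BG m :=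
  ⟨(fun i => (L i).vertex y, fun i => (L i.castSucc).between (L i.succ) y),
    fun _ => ⟨r_between _ _ y, s_between _ _ y⟩⟩

theorem isLocalHomeomorph_string (he : 𝒢.IsEtale) (hπ : IsLocalHomeomorph π) {m : ℕ}
    (L : Fin (m + 1) → 𝒢.RangeSection π) : IsLocalHomeomorph (string L) :=
  IsLocalHomeomorph.of_comp (g := fun p : 𝒢.BG m => p.obj 0)
    ((L 0).isLocalHomeomorph_vertex he hπ) (isLocalHomeomorph_obj he 0)
    (BG.continuous_of (fun i => (L i).continuous_vertex) fun _ => continuous_between _ _)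

end RangeSection

/-- The product of the first `k` arrows of a string, which joins its initial object to its `k`-th
object. For `k > n` the value is irrelevant. -/
def BG.initialArrow {n : ℕ} (p : 𝒢.BG n) : ℕ → G
  | 0 => 𝒢.unit (p.obj 0)
  | k + 1 => if h : k < n then 𝒢.mul (p.initialArrow k) (p.arrow ⟨k, h⟩) else 𝒢.unit (p.obj 0)

theorem BG.r_s_initialArrow {n : ℕ} (p : 𝒢.BG n) (k : ℕ) (hk : k < n + 1) :
    𝒢.r (p.initialArrow k) = p.obj 0 ∧ 𝒢.s (p.initialArrow k) = p.obj ⟨k, hk⟩ := by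
  induction k with
  | zero => exact ⟨𝒢.r_unit _, 𝒢.s_unit _⟩
  | succ k ih =>
    have hk' : k < n := by omega
    obtain ⟨h1, h2⟩ := ih (by omega)
    have h3 : 𝒢.s (p.initialArrow k) = 𝒢.r (p.arrow ⟨k, hk'⟩) := by rw [h2, r_arrow]; rfl
    rw [initialArrow, dif_pos hk', 𝒢.r_mul _ _ h3, 𝒢.s_mul _ _ h3, s_arrow]
    exact ⟨h1, rfl⟩

theorem BG.continuous_initialArrow {n : ℕ} (k : ℕ) (hk : k < n + 1) :
    Continuous fun p : 𝒢.BG n => p.initialArrow k := by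
  induction k with
  | zero => exact 𝒢.continuous_unit.comp (BG.continuous_obj 0)
  | succ k ih =>
    have hk' : k < n := by omega
    simp only [initialArrow, dif_pos hk']
    refine 𝒢.continuousOn_mul.comp_continuous ((ih (by omega)).prodMk (BG.continuous_arrow _))
      fun p => ?_
    exact (p.r_s_initialArrow k (by omega)).2.trans (p.r_arrow ⟨k, hk'⟩).symm

/-- The `i`-th object of a string as the vertex of a range section. -/
def BG.section (n : ℕ) (i : Fin (n + 1)) : 𝒢.RangeSection fun p : 𝒢.BG n => p.obj 0 where
  arrow p := p.initialArrow i
  continuous_arrow := BG.continuous_initialArrow i i.2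
  r_arrow p := (p.r_s_initialArrow i i.2).1

theorem BG.vertex_section {n : ℕ} (i : Fin (n + 1)) (p : 𝒢.BG n) :
    (BG.section n i).vertex p = p.obj i :=
  (p.r_s_initialArrow i i.2).2

end TopologicalGroupoid

/-! ### Operators on compactly supported functions given by integral kernels -/

namespace CompactlySupportedContinuousMap

/-- Multiplication by a continuous function. -/
def mulLeftHom {Y : Type*} [TopologicalSpace Y] (w : C(Y, ℤ)) : C_c(Y, ℤ) →+ C_c(Y, ℤ) where
  toFun a :=
    { toFun := fun y => w y * a y
      continuous_toFun := w.continuous.mul a.continuous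
      hasCompactSupport' := a.hasCompactSupport.mul_left }
  map_zero' := by ext y; simp
  map_add' a b := by ext y; simp [mul_add]

@[simp]
theorem mulLeftHom_apply {Y : Type*} [TopologicalSpace Y] (w : C(Y, ℤ)) (a : C_c(Y, ℤ)) (y : Y) :
    mulLeftHom w a y = w y * a y := rfl

end CompactlySupportedContinuousMap

namespace OrderedChain

open Finsupp

variable {X : Type*}

theorem bd_mem_supported (l : List X) :
    bd l ∈ supported ℤ ℤ {k : List X | k.length + 1 = l.length} := by
  induction l with
  | nil => exact zero_mem _
  | cons y l ih =>
    refine sub_mem (single_mem_supported ℤ _ (by simp)) ?_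
    suffices h : supported ℤ ℤ {k : List X | k.length + 1 = l.length} ≤
        (supported ℤ ℤ {k : List X | k.length + 1 = (y :: l).length}).comap (cone y) from h ih
    rw [supported_eq_span_single, Submodule.span_le]
    rintro _ ⟨k, hk, rfl⟩
    refine Submodule.mem_comap.2 ?_
    rw [cone_single]
    exact single_mem_supported ℤ _ (by simpa using hk)

theorem bdL_apply_eq_zero {m : ℕ} {u : List X →₀ ℤ} (hu : ∀ l, l.length = m + 1 → u l = 0)
    {k : List X} (hk : k.length = m) : bdL u k = 0 := by
  rw [bdL, linearCombination_apply, Finsupp.sum, Finsupp.finsetSum_apply]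
  refine Finset.sum_eq_zero fun l hl => ?_
  rw [Finsupp.smul_apply]
  by_cases h : k ∈ (bd l).support
  · have h1 : k.length + 1 = l.length := (mem_supported ℤ _).1 (bd_mem_supported l) h
    rw [hu l (by omega), zero_smul]
  · rw [notMem_support_iff.1 h, smul_zero]

end OrderedChain

namespace TopologicalGroupoid

open CompactlySupportedContinuousMap OrderedChain

variable {X G : Type*} [TopologicalSpace X] [TopologicalSpace G]
  {𝒢 : TopologicalGroupoid X G}

section Admissible

variable {Y : Type*} [TopologicalSpace Y]

variable {π : Y → X}

variable (𝒢 π) in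
/-- The kernels on `Y` (with values in chains on the set of objects) that are sums of kernels sending
`y` to an integer `w y`, depending continuously on `y`, times a simplex whose vertices are given
by range sections. -/
noncomputable def admissible : AddSubgroup (Y → List X →₀ ℤ) :=
  AddSubgroup.closure {T | ∃ (w : C(Y, ℤ)) (L : List (𝒢.RangeSection π)),
    T = fun y => w y • Finsupp.single (L.map fun v => v.vertex y) 1}

theorem admissible_single (L : List (𝒢.RangeSection π)) :
    (fun y => Finsupp.single (L.map fun v => v.vertex y) (1 : ℤ)) ∈ admissible 𝒢 π :=
  AddSubgroup.subset_closure ⟨1, L, by simp⟩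

theorem admissible_map {Φ : Y → (List X →₀ ℤ) →ₗ[ℤ] (List X →₀ ℤ)}
    (hΦ : ∀ (w : C(Y, ℤ)) (L : List (𝒢.RangeSection π)),
      (fun y => w y • Φ y (Finsupp.single (L.map fun v => v.vertex y) 1)) ∈ admissible 𝒢 π)
    {T : Y → List X →₀ ℤ} (hT : T ∈ admissible 𝒢 π) : (fun y => Φ y (T y)) ∈ admissible 𝒢 π := by
  let Ψ : (Y → List X →₀ ℤ) →+ (Y → List X →₀ ℤ) :=
    { toFun := fun T y => Φ y (T y)
      map_zero' := by ext; simp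
      map_add' := fun S T => by funext y; simp }
  suffices h : admissible 𝒢 π ≤ (admissible 𝒢 π).comap Ψ from h hT
  refine (AddSubgroup.closure_le _).2 ?_
  rintro _ ⟨w, L, rfl⟩
  rw [SetLike.mem_coe, AddSubgroup.mem_comap]
  simpa only [Ψ, AddMonoidHom.coe_mk, ZeroHom.coe_mk, map_smul] using hΦ w L

theorem admissible_smul (w : C(Y, ℤ)) {T : Y → List X →₀ ℤ} (hT : T ∈ admissible 𝒢 π) :
    (fun y => w y • T y) ∈ admissible 𝒢 π := by
  refine admissible_map (Φ := fun y => w y • LinearMap.id) (fun w' L => ?_) hT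
  refine AddSubgroup.subset_closure ⟨w' * w, L, ?_⟩
  simp [mul_smul]

theorem admissible_cone (v : 𝒢.RangeSection π) {T : Y → List X →₀ ℤ}
    (hT : T ∈ admissible 𝒢 π) : (fun y => cone (v.vertex y) (T y)) ∈ admissible 𝒢 π := by
  refine admissible_map (Φ := fun y => cone (v.vertex y)) (fun w L => ?_) hT
  exact AddSubgroup.subset_closure ⟨w, v :: L, by simp⟩

variable {ι : Type*} [LinearOrder ι] {c : X → ι}

theorem admissible_insL (hc : IsLocallyConstant c) (v : 𝒢.RangeSection π) {T : Y → List X →₀ ℤ}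
    (hT : T ∈ admissible 𝒢 π) : (fun y => insL c (v.vertex y) (T y)) ∈ admissible 𝒢 π := by
  refine admissible_map (Φ := fun y => insL c (v.vertex y)) (fun w L => admissible_smul w ?_) hT
  simp only [insL_single]
  induction L with
  | nil => exact admissible_single [v]
  | cons u L ih =>
    -- the weights are the indicator functions of two clopen sets
    have hlt : ∀ v w : 𝒢.RangeSection π,
        Continuous fun y => if c (v.vertex y) < c (w.vertex y) then (1 : ℤ) else 0 := by
      intro v w
      exact (((hc.comp_continuous v.continuous_vertex).prodMk
        (hc.comp_continuous w.continuous_vertex)).comp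
        fun i : ι × ι => if i.1 < i.2 then (1 : ℤ) else 0).continuous
    convert add_mem (admissible_smul ⟨_, hlt v u⟩ (admissible_single (v :: u :: L)))
      (admissible_smul ⟨_, hlt u v⟩ (neg_mem (admissible_cone u ih))) using 1
    funext y
    simp only [List.map_cons, ins, ContinuousMap.coe_mk, Pi.add_apply, Pi.neg_apply]
    split_ifs with h1 h2 h2
    · exact absurd h1 h2.le.not_gt
    · simp
    · simp
    · simp

theorem admissible_sort (hc : IsLocallyConstant c) (γ : 𝒢.RangeSection (id : X → X))
    (L : List (𝒢.RangeSection π)) :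
    (fun y => sort c γ.vertex (L.map fun v => v.vertex y)) ∈ admissible 𝒢 π := by
  induction L with
  | nil => exact admissible_single []
  | cons v L ih =>
    simp only [List.map_cons, sort, ← RangeSection.vertex_trans]
    exact admissible_insL hc _ ih

theorem admissible_prism (hc : IsLocallyConstant c) (γ : 𝒢.RangeSection (id : X → X))
    (L : List (𝒢.RangeSection π)) :
    (fun y => prism c γ.vertex (L.map fun v => v.vertex y)) ∈ admissible 𝒢 π := by
  induction L with
  | nil => exact zero_mem _
  | cons v L ih =>
    have h := admissible_sort hc γ L
    simp only [List.map_cons, prism, ← RangeSection.vertex_trans]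
    exact sub_mem (admissible_cone v (sub_mem (admissible_cone v h) (admissible_insL hc _ h)))
      (admissible_cone v ih)

theorem BG.objs_eq_map_vertex {n : ℕ} (p : 𝒢.BG n) :
    p.objs = (List.ofFn (BG.section n)).map fun v => v.vertex p := by
  rw [List.map_ofFn, objs]
  congr 1
  funext i
  exact (BG.vertex_section i p).symm

end Admissible

variable [T2Space X] [T2Space G] {Y Z : Type*} [TopologicalSpace Y] [T2Space Y]
  [TopologicalSpace Z] [T2Space Z]

variable (𝒢 Y) in
/-- The pairs of a kernel `T` and an operator `θ` on compactly supported functions such that `θ` is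
obtained by integrating the part of `T` in degree `m`. They are generated by
multiplication with a continuous function followed by push-forward along a local homeomorphism to
`BG_m`, and by the kernels that vanish in degree `m`, which act as `0`. -/
noncomputable def realized (m : ℕ) :
    AddSubgroup ((Y → List X →₀ ℤ) × (C_c(Y, ℤ) →+ C_c(𝒢.BG m, ℤ))) :=
  AddSubgroup.closure
    ({x | ∃ (w : C(Y, ℤ)) (f : Y → 𝒢.BG m) (hf : IsLocalHomeomorph f),
        x = (fun y => w y • Finsupp.single (f y).objs 1, hf.pushforward.comp (mulLeftHom w))} ∪
      {x | x.2 = 0 ∧ ∀ y l, l.length = m + 1 → x.1 y l = 0})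

/-- The operator is determined by its kernel: `θ a = ∑_y a(y) T(y)`. -/
theorem realized_apply (hp : 𝒢.IsPrincipal) {m : ℕ}
    {x : (Y → List X →₀ ℤ) × (C_c(Y, ℤ) →+ C_c(𝒢.BG m, ℤ))} (hx : x ∈ realized 𝒢 Y m)
    (a : C_c(Y, ℤ)) (q : 𝒢.BG m) :
    (Function.support fun y => a y * x.1 y q.objs).Finite ∧
      x.2 a q = ∑ᶠ y, a y * x.1 y q.objs := by
  induction hx using AddSubgroup.closure_induction with
  | mem x hx =>
    rcases hx with ⟨w, f, hf, rfl⟩ | ⟨h1, h2⟩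
    · classical
      have h : ∀ y, a y * (w y • Finsupp.single (f y).objs (1 : ℤ)) q.objs =
          (f ⁻¹' {q}).indicator (fun y => w y * a y) y := by
        intro y
        have h1 := (BG.objs_injective hp m).eq_iff (a := f y) (b := q)
        rw [Finsupp.smul_apply, Finsupp.single_apply, Set.indicator_apply]
        by_cases h2 : f y = q <;> simp [h1, h2, mul_comm]
      simp only [h]
      refine ⟨(hf.finite_fiber_inter_support a q).subset fun y hy => ?_, ?_⟩
      · rw [Set.support_indicator] at hy
        exact ⟨hy.1, right_ne_zero_of_mul hy.2⟩
      · rw [← finsum_mem_def]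
        rfl
    · simp [h1, h2 _ q.objs (List.length_ofFn)]
  | zero => simp
  | add x y _ _ hx hy =>
    simp only [Prod.fst_add, Prod.snd_add, Pi.add_apply, Finsupp.add_apply, mul_add]
    refine ⟨(hx.1.union hy.1).subset (Function.support_add _ _), ?_⟩
    rw [finsum_add_distrib hx.1 hy.1, ← hx.2, ← hy.2]
    rfl
  | neg x _ hx =>
    simp only [Prod.fst_neg, Prod.snd_neg, Pi.neg_apply, Finsupp.neg_apply, mul_neg]
    refine ⟨hx.1.subset fun y hy => neg_ne_zero.1 hy, ?_⟩
    rw [finsum_neg_distrib, ← hx.2]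
    rfl

/-- Identities between operators can be verified on their kernels, pointwise on the support. -/
theorem realized_eq_zero (hp : 𝒢.IsPrincipal) {m : ℕ} {T : Y → List X →₀ ℤ}
    {θ : C_c(Y, ℤ) →+ C_c(𝒢.BG m, ℤ)} (hx : (T, θ) ∈ realized 𝒢 Y m)
    {a : C_c(Y, ℤ)} (h : ∀ y, a y ≠ 0 → T y = 0) : θ a = 0 := by
  ext q
  rw [(realized_apply hp hx a q).2]
  refine (finsum_congr fun y => ?_).trans finsum_zero
  by_cases hy : a y = 0
  · simp [hy]
  · simp [h y hy]

theorem realized_add {m : ℕ} {S T : Y → List X →₀ ℤ} {σ τ : C_c(Y, ℤ) →+ C_c(𝒢.BG m, ℤ)}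
    (hS : (S, σ) ∈ realized 𝒢 Y m) (hT : (T, τ) ∈ realized 𝒢 Y m) :
    (fun y => S y + T y, σ + τ) ∈ realized 𝒢 Y m := add_mem hS hT

theorem realized_sub {m : ℕ} {S T : Y → List X →₀ ℤ} {σ τ : C_c(Y, ℤ) →+ C_c(𝒢.BG m, ℤ)}
    (hS : (S, σ) ∈ realized 𝒢 Y m) (hT : (T, τ) ∈ realized 𝒢 Y m) :
    (fun y => S y - T y, σ - τ) ∈ realized 𝒢 Y m := sub_mem hS hT

theorem realized_alternating_sum {k m : ℕ} {T : Fin k → Y → List X →₀ ℤ}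
    {θ : Fin k → C_c(Y, ℤ) →+ C_c(𝒢.BG m, ℤ)} (h : ∀ i, (T i, θ i) ∈ realized 𝒢 Y m) :
    (fun y => ∑ i : Fin k, (-1 : ℤ) ^ (i : ℕ) • T i y, ∑ i : Fin k, (-1 : ℤ) ^ (i : ℕ) • θ i) ∈
      realized 𝒢 Y m := by
  convert sum_mem (t := Finset.univ) fun (i : Fin k) _ =>
    zsmul_mem (h i) ((-1 : ℤ) ^ (i : ℕ)) using 1
  refine Prod.ext (funext fun y => ?_) ?_
  · simp [Prod.fst_sum, Finset.sum_apply]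
  · simp [Prod.snd_sum]

theorem realized_id (n : ℕ) :
    (fun p : 𝒢.BG n => Finsupp.single p.objs (1 : ℤ), AddMonoidHom.id _) ∈
      realized 𝒢 (𝒢.BG n) n := by
  have hid : IsLocalHomeomorph (id : 𝒢.BG n → 𝒢.BG n) := (Homeomorph.refl _).isLocalHomeomorph
  refine AddSubgroup.subset_closure (Or.inl ⟨1, id, hid, Prod.ext ?_ ?_⟩)
  · funext p
    simp
  · ext a q
    change a q = ∑ᶠ y ∈ id ⁻¹' {q}, (1 : C(𝒢.BG n, ℤ)) y * a y
    simp

theorem realized_bdL (he : 𝒢.IsEtale) {m : ℕ} {T : Y → List X →₀ ℤ}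
    {θ : C_c(Y, ℤ) →+ C_c(𝒢.BG (m + 1), ℤ)} (hx : (T, θ) ∈ realized 𝒢 Y (m + 1)) :
    (fun y => bdL (T y), (𝒢.boundary he m).comp θ) ∈ realized 𝒢 Y m := by
  let Φ : ((Y → List X →₀ ℤ) × (C_c(Y, ℤ) →+ C_c(𝒢.BG (m + 1), ℤ))) →+
      ((Y → List X →₀ ℤ) × (C_c(Y, ℤ) →+ C_c(𝒢.BG m, ℤ))) :=
    (bdL.toAddMonoidHom.compLeft Y).prodMap (AddMonoidHom.compHom (𝒢.boundary he m))
  suffices h : realized 𝒢 Y (m + 1) ≤ (realized 𝒢 Y m).comap Φ from h hx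
  rw [realized, AddSubgroup.closure_le]
  rintro x (⟨w, f, hf, rfl⟩ | ⟨h1, h2⟩)
  · rw [SetLike.mem_coe, AddSubgroup.mem_comap]
    convert realized_alternating_sum (T := fun (i : Fin (m + 2)) y => w y •
        Finsupp.single (face i (f y)).objs (1 : ℤ))
      (θ := fun i => ((isLocalHomeomorph_face he i).comp hf).pushforward.comp (mulLeftHom w))
      fun i => AddSubgroup.subset_closure
        (Or.inl ⟨w, _, (isLocalHomeomorph_face he i).comp hf, rfl⟩) using 1
    refine Prod.ext (funext fun y => ?_) (AddMonoidHom.ext fun a => ?_)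
    · change bdL (w y • Finsupp.single (f y).objs (1 : ℤ)) = _
      rw [map_smul, bdL_single, BG.bd_objs, Finset.smul_sum]
      exact Finset.sum_congr rfl fun i _ => smul_comm _ _ _
    · change 𝒢.boundary he m (hf.pushforward (mulLeftHom w a)) = _
      rw [boundary_apply, AddMonoidHom.finsetSum_apply]
      simp only [IsLocalHomeomorph.pushforward_pushforward]
      rfl
  · refine AddSubgroup.subset_closure (Or.inr ⟨?_, fun y l hl => ?_⟩)
    · simp [Φ, h1]
    · exact bdL_apply_eq_zero (h2 y) hl

theorem realized_comp {m : ℕ} {T : Z → List X →₀ ℤ}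
    {θ : C_c(Z, ℤ) →+ C_c(𝒢.BG m, ℤ)} (hx : (T, θ) ∈ realized 𝒢 Z m) {g : Y → Z}
    (hg : IsLocalHomeomorph g) :
    (fun y => T (g y), θ.comp hg.pushforward) ∈ realized 𝒢 Y m := by
  let Φ : ((Z → List X →₀ ℤ) × (C_c(Z, ℤ) →+ C_c(𝒢.BG m, ℤ))) →+
      ((Y → List X →₀ ℤ) × (C_c(Y, ℤ) →+ C_c(𝒢.BG m, ℤ))) :=
    { toFun := fun x => (fun y => x.1 (g y), x.2.comp hg.pushforward)
      map_zero' := by ext <;> simp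
      map_add' := fun x y => rfl }
  suffices h : realized 𝒢 Z m ≤ (realized 𝒢 Y m).comap Φ from h hx
  rw [realized, AddSubgroup.closure_le]
  rintro x (⟨w, f, hf, rfl⟩ | ⟨h1, h2⟩)
  · refine AddSubgroup.subset_closure (Or.inl ⟨w.comp ⟨g, hg.continuous⟩, f ∘ g, hf.comp hg,
      Prod.ext rfl (AddMonoidHom.ext fun a => ?_)⟩)
    simp only [Φ, AddMonoidHom.coe_mk, ZeroHom.coe_mk, AddMonoidHom.comp_apply]
    rw [← IsLocalHomeomorph.pushforward_pushforward hg hf]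
    congr 1
    -- the projection formula
    ext z
    rw [mulLeftHom_apply, IsLocalHomeomorph.pushforward_apply, IsLocalHomeomorph.pushforward_apply,
      mul_finsum_mem]
    refine finsum_mem_congr rfl fun y hy => ?_
    rw [Set.mem_preimage, Set.mem_singleton_iff] at hy
    simp [hy]
  · exact AddSubgroup.subset_closure (Or.inr ⟨by simp [Φ, h1], fun y l hl => h2 (g y) l hl⟩)

theorem realized_comp_bd (he : 𝒢.IsEtale) {n m : ℕ} {S : (List X →₀ ℤ) →ₗ[ℤ] (List X →₀ ℤ)}
    {θ : C_c(𝒢.BG n, ℤ) →+ C_c(𝒢.BG m, ℤ)}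
    (hx : (fun p => S (Finsupp.single p.objs 1), θ) ∈ realized 𝒢 (𝒢.BG n) m) :
    (fun p => S (bd p.objs), θ.comp (𝒢.boundary he n)) ∈ realized 𝒢 (𝒢.BG (n + 1)) m := by
  convert realized_alternating_sum (T := fun (i : Fin (n + 2)) p => S (Finsupp.single
    (face i p).objs 1)) (θ := fun i => θ.comp (isLocalHomeomorph_face he i).pushforward)
    fun i => realized_comp hx (isLocalHomeomorph_face he i) using 1
  refine Prod.ext (funext fun p => ?_) (AddMonoidHom.ext fun a => ?_)
  · simp only [BG.bd_objs, map_sum, map_smul]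
  · change θ (𝒢.boundary he n a) = _
    rw [boundary_apply, AddMonoidHom.finsetSum_apply, map_sum]
    simp only [map_zsmul]
    rfl

theorem exists_mem_realized (he : 𝒢.IsEtale) {π : Y → X} (hπ : IsLocalHomeomorph π)
    {T : Y → List X →₀ ℤ} (hT : T ∈ admissible 𝒢 π) (m : ℕ) : ∃ θ, (T, θ) ∈ realized 𝒢 Y m := by
  suffices h : admissible 𝒢 π ≤ (realized 𝒢 Y m).map (AddMonoidHom.fst _ _) by
    obtain ⟨⟨_, θ⟩, h, rfl⟩ := h hT
    exact ⟨θ, h⟩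
  rw [admissible, AddSubgroup.closure_le]
  rintro _ ⟨w, L, rfl⟩
  obtain ⟨n, L, rfl⟩ : ∃ (n : ℕ) (L' : Fin n → 𝒢.RangeSection π), L = List.ofFn L' :=
    ⟨_, L.get, (List.ofFn_get L).symm⟩
  by_cases h : n = m + 1
  · subst h
    refine ⟨_, AddSubgroup.subset_closure (Or.inl ⟨w, RangeSection.string L,
      RangeSection.isLocalHomeomorph_string he hπ L, rfl⟩), ?_⟩
    simp only [AddMonoidHom.coe_fst, List.map_ofFn]
    rfl
  · classical
    refine ⟨(_, 0), AddSubgroup.subset_closure (Or.inr ⟨rfl, fun y l hl => ?_⟩), rfl⟩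
    change (w y • Finsupp.single ((List.ofFn L).map fun v => v.vertex y) (1 : ℤ)) l = 0
    rw [Finsupp.smul_apply, Finsupp.single_apply, if_neg, smul_zero]
    rintro rfl
    simp only [List.length_map, List.length_ofFn] at hl
    exact h hl

variable {ι : Type*} [LinearOrder ι] {c : X → ι}

variable (𝒢) in
/-- The cycles of the chain complex `C_c(BG_•, ℤ)`; every element of degree `0` is a cycle. -/
def IsCycle (he : 𝒢.IsEtale) : ∀ {n : ℕ}, C_c(𝒢.BG n, ℤ) → Prop
  | 0, _ => True
  | n + 1, a => 𝒢.boundary he n a = 0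

theorem exists_realized_sort (he : 𝒢.IsEtale) (hc : IsLocallyConstant c)
    (γ : 𝒢.RangeSection (id : X → X)) (n m : ℕ) :
    ∃ ρ, (fun p : 𝒢.BG n => sort c γ.vertex p.objs, ρ) ∈ realized 𝒢 (𝒢.BG n) m := by
  simp only [BG.objs_eq_map_vertex]
  exact exists_mem_realized he (isLocalHomeomorph_obj he 0) (admissible_sort hc γ _) m

theorem exists_realized_prism (he : 𝒢.IsEtale) (hc : IsLocallyConstant c)
    (γ : 𝒢.RangeSection (id : X → X)) (n m : ℕ) :
    ∃ h, (fun p : 𝒢.BG n => prism c γ.vertex p.objs, h) ∈ realized 𝒢 (𝒢.BG n) m := by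
  simp only [BG.objs_eq_map_vertex]
  exact exists_mem_realized he (isLocalHomeomorph_obj he 0) (admissible_prism hc γ _) m

/-- A cycle is homologous to its image under sorting. -/
theorem exists_boundary_eq_sub (he : 𝒢.IsEtale) (hp : 𝒢.IsPrincipal) (hc : IsLocallyConstant c)
    (γ : 𝒢.RangeSection (id : X → X)) {n : ℕ} {a : C_c(𝒢.BG n, ℤ)} (ha : 𝒢.IsCycle he a)
    (hcomp : ∀ p, a p ≠ 0 → Compatible c γ.vertex p.objs)
    {ρ : C_c(𝒢.BG n, ℤ) →+ C_c(𝒢.BG n, ℤ)}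
    (hρ : (fun p => sort c γ.vertex p.objs, ρ) ∈ realized 𝒢 (𝒢.BG n) n) :
    ∃ b, 𝒢.boundary he n b = a - ρ a := by
  obtain ⟨h, hh⟩ := exists_realized_prism he hc γ n (n + 1)
  -- `θ` is the term `h ∘ ∂` of the homotopy formula; in degree `0` its kernel vanishes, because the
  -- augmentation only contributes the empty simplex, on which the homotopy is zero
  obtain ⟨θ, hθ, hθa⟩ : ∃ θ, (fun p : 𝒢.BG n => prismL c γ.vertex (bd p.objs), θ) ∈
      realized 𝒢 (𝒢.BG n) n ∧ θ a = 0 := by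
    cases n with
    | zero =>
      refine ⟨0, ?_, rfl⟩
      convert zero_mem (realized 𝒢 (𝒢.BG 0) 0) using 1
      refine Prod.ext (funext fun p => ?_) rfl
      simp [BG.objs, bd, prism]
    | succ n =>
      obtain ⟨h', hh'⟩ := exists_realized_prism he hc γ n (n + 1)
      refine ⟨h'.comp (𝒢.boundary he n), realized_comp_bd he (S := prismL c γ.vertex) ?_, ?_⟩
      · simpa only [prismL_single] using hh'
      · rw [AddMonoidHom.comp_apply, show 𝒢.boundary he n a = 0 from ha, map_zero]
  have key := realized_eq_zero hp (a := a) (realized_sub (realized_add (realized_bdL he hh) hθ)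
    (realized_sub (realized_id n) hρ)) fun p hpa => sub_eq_zero.2 (hcomp p hpa).bdL_prism_add
  refine ⟨h a, ?_⟩
  simpa [sub_eq_zero, hθa] using key

/-- Above the dimension given by the number of colours sorting is zero, so cycles are boundaries. -/
theorem exists_boundary_eq (he : 𝒢.IsEtale) (hp : 𝒢.IsPrincipal) (hc : IsLocallyConstant c)
    [Fintype ι] (γ : 𝒢.RangeSection (id : X → X)) {n : ℕ} (hn : Fintype.card ι < n + 1)
    {a : C_c(𝒢.BG n, ℤ)} (ha : 𝒢.IsCycle he a)
    (hcomp : ∀ p, a p ≠ 0 → Compatible c γ.vertex p.objs) : ∃ b, 𝒢.boundary he n b = a := by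
  obtain ⟨ρ, hρ⟩ := exists_realized_sort he hc γ n n
  obtain ⟨b, hb⟩ := exists_boundary_eq_sub he hp hc γ ha hcomp hρ
  refine ⟨b, ?_⟩
  rw [hb, realized_eq_zero hp hρ fun p _ => sort_eq_zero c _ (by simpa [BG.objs, Nat.lt_succ_iff] using hn),
    sub_zero]

/-- In the top dimension sorting annihilates boundaries, and it takes values in the torsion-free
group of integer-valued functions; so it annihilates every cycle with a multiple that is a
boundary. -/
theorem exists_boundary_eq_of_nsmul (he : 𝒢.IsEtale) (hp : 𝒢.IsPrincipal)
    (hc : IsLocallyConstant c) [Fintype ι] (γ : 𝒢.RangeSection (id : X → X)) {n : ℕ}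
    (hn : Fintype.card ι < n + 2) {a : C_c(𝒢.BG n, ℤ)} (ha : 𝒢.IsCycle he a)
    (hcomp : ∀ p, a p ≠ 0 → Compatible c γ.vertex p.objs) {m : ℕ} (hm : m ≠ 0)
    {b : C_c(𝒢.BG (n + 1), ℤ)} (hb : 𝒢.boundary he n b = m • a)
    (hcomp' : ∀ p, b p ≠ 0 → Compatible c γ.vertex p.objs) : ∃ b, 𝒢.boundary he n b = a := by
  obtain ⟨ρ, hρ⟩ := exists_realized_sort he hc γ n n
  obtain ⟨b', hb'⟩ := exists_boundary_eq_sub he hp hc γ ha hcomp hρ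
  have h1 : ρ (𝒢.boundary he n b) = 0 := by
    refine realized_eq_zero hp (realized_comp_bd he (S := sortL c γ.vertex)
      (by simpa only [sortL_single] using hρ)) fun p hpb => ?_
    rw [← (hcomp' p hpb).bdL_sort,
      sort_eq_zero c _ (by simpa [BG.objs, Nat.lt_succ_iff] using hn), map_zero]
  have h2 : ρ a = 0 := by
    rw [hb, map_nsmul] at h1
    ext q
    have h3 := DFunLike.congr_fun h1 q
    simpa [hm] using h3
  exact ⟨b', by rw [hb', h2, sub_zero]⟩

end TopologicalGroupoid

/-! ### Compact open subgroupoids -/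

theorem IsLocallyConstant.isClopen_preimage {X ι : Type*} [TopologicalSpace X] {f : X → ι}
    (hf : IsLocallyConstant f) (s : Set ι) : IsClopen (f ⁻¹' s) :=
  ⟨isOpen_compl_iff.1 (hf sᶜ), hf s⟩

/-- In a zero-dimensional space the members of an open cover of a compact set that contain its
points can be chosen in a locally constant way. -/
theorem IsCompact.exists_isLocallyConstant_mem {X ι : Type*} [TopologicalSpace X] [T2Space X]
    [Nonempty ι] (hX : ∀ (x : X) (U : Set X), IsOpen U → x ∈ U →
      ∃ V, IsCompact V ∧ IsOpen V ∧ x ∈ V ∧ V ⊆ U)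
    {M : Set X} (hM : IsCompact M) {U : ι → Set X} (hU : ∀ i, IsOpen (U i)) (hMU : M ⊆ ⋃ i, U i) :
    ∃ c : X → ι, IsLocallyConstant c ∧ ∀ x ∈ M, x ∈ U (c x) := by
  classical
  suffices h : ∃ C : Set X, IsClopen C ∧ M ⊆ C ∧ ∃ c : X → ι, IsLocallyConstant c ∧
      ∀ x ∈ C, x ∈ U (c x) by
    obtain ⟨C, -, hMC, c, hc, hcU⟩ := h
    exact ⟨c, hc, fun x hx => hcU x (hMC hx)⟩
  refine hM.induction_on (p := fun M => ∃ C : Set X, IsClopen C ∧ M ⊆ C ∧ ∃ c : X → ι,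
    IsLocallyConstant c ∧ ∀ x ∈ C, x ∈ U (c x)) ?_ ?_ ?_ ?_
  · exact ⟨∅, isClopen_empty, subset_rfl, fun _ => Classical.arbitrary ι,
      IsLocallyConstant.const _, fun x hx => hx.elim⟩
  · rintro s t hst ⟨C, h1, h2, h3⟩
    exact ⟨C, h1, hst.trans h2, h3⟩
  · rintro s t ⟨C, hC, hsC, c, hc, hcU⟩ ⟨D, hD, htD, e, he, heU⟩
    refine ⟨C ∪ D, hC.union hD, Set.union_subset_union hsC htD, fun x => if x ∈ C then c x else e x,
      ?_, ?_⟩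
    · rw [IsLocallyConstant.iff_eventually_eq] at hc he ⊢
      intro x
      by_cases hx : x ∈ C
      · filter_upwards [hc x, hC.isOpen.mem_nhds hx] with y hy hyC
        rw [if_pos hx, if_pos hyC, hy]
      · filter_upwards [he x, hC.isClosed.isOpen_compl.mem_nhds hx] with y hy hyC
        rw [if_neg hx, if_neg hyC, hy]
    · intro x hx
      dsimp only
      split_ifs with hxC
      · exact hcU x hxC
      · exact heU x (hx.resolve_left hxC)
  · intro x hx
    obtain ⟨i, hi⟩ := Set.mem_iUnion.1 (hMU hx)
    obtain ⟨V, hVc, hVo, hxV, hVU⟩ := hX x _ (hU i) hi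
    exact ⟨V, mem_nhdsWithin_of_mem_nhds (hVo.mem_nhds hxV), V, ⟨hVc.isClosed, hVo⟩, subset_rfl,
      fun _ => i, IsLocallyConstant.const _, fun y hy => hVU hy⟩

/-- The fibres of a local homeomorphism meet a compact set in boundedly many points. -/
theorem IsLocalHomeomorph.exists_ncard_fiber_le {Y Z : Type*} [TopologicalSpace Y]
    [TopologicalSpace Z] {f : Y → Z} (hf : IsLocalHomeomorph f) {K : Set Y} (hK : IsCompact K) :
    ∃ N : ℕ, ∀ z, ({y ∈ K | f y = z}).Finite ∧ ({y ∈ K | f y = z}).ncard ≤ N := by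
  choose e he hfe using hf
  obtain ⟨t, ht, hcov⟩ := hK.elim_nhds_subcover (fun y => (e y).source)
    (fun y _ => (e y).open_source.mem_nhds (he y))
  have hcov' : ∀ y ∈ K, ∃ x ∈ t, y ∈ (e x).source := fun y hy => by
    simpa using hcov hy
  choose! i hit hi using hcov'
  have hmaps : ∀ z, Set.MapsTo i {y ∈ K | f y = z} t := fun z y hy => hit y hy.1
  have hinj : ∀ z, Set.InjOn i {y ∈ K | f y = z} := by
    rintro z y ⟨hy, rfl⟩ y' ⟨hy', hyy⟩ h
    refine (e (i y)).injOn (hi y hy) (h ▸ hi y' hy') ?_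
    rw [← hfe, hyy]
  refine ⟨t.card, fun z => ⟨Set.Finite.of_injOn (hmaps z) (hinj z) t.finite_toSet, ?_⟩⟩
  rw [← Set.ncard_coe_finset]
  exact Set.ncard_le_ncard_of_injOn i (hmaps z) (hinj z) t.finite_toSet

namespace TopologicalGroupoid

variable {X G : Type*} [TopologicalSpace X] [TopologicalSpace G]
  {𝒢 : TopologicalGroupoid X G}

theorem inv_mul_mul {g h : G} (hgh : 𝒢.s g = 𝒢.r h) : 𝒢.mul (𝒢.inv g) (𝒢.mul g h) = h := by
  rw [← 𝒢.mul_assoc _ _ _ (𝒢.s_inv g) hgh, 𝒢.inv_mul, hgh, 𝒢.unit_mul]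

theorem mul_inv_mul {g h : G} (hgh : 𝒢.r g = 𝒢.r h) : 𝒢.mul g (𝒢.mul (𝒢.inv g) h) = h := by
  rw [← 𝒢.mul_assoc _ _ _ (𝒢.r_inv g).symm (by rw [𝒢.s_inv, hgh]), 𝒢.mul_inv, hgh, 𝒢.unit_mul]

theorem inv_mul_rev (hp : 𝒢.IsPrincipal) {g h : G} (hgh : 𝒢.s g = 𝒢.r h) :
    𝒢.inv (𝒢.mul g h) = 𝒢.mul (𝒢.inv h) (𝒢.inv g) := by
  have h1 : 𝒢.s (𝒢.inv h) = 𝒢.r (𝒢.inv g) := by rw [𝒢.s_inv, 𝒢.r_inv, hgh]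
  refine hp.eq_of_r_eq_of_s_eq ?_ ?_
  · rw [𝒢.r_inv, 𝒢.s_mul _ _ hgh, 𝒢.r_mul _ _ h1, 𝒢.r_inv]
  · rw [𝒢.s_inv, 𝒢.r_mul _ _ hgh, 𝒢.s_mul _ _ h1, 𝒢.s_inv]

theorem inv_unit (hp : 𝒢.IsPrincipal) (x : X) : 𝒢.inv (𝒢.unit x) = 𝒢.unit x :=
  hp.eq_of_r_eq_of_s_eq (by rw [𝒢.r_inv, 𝒢.r_unit, 𝒢.s_unit])
    (by rw [𝒢.s_inv, 𝒢.r_unit, 𝒢.s_unit])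

theorem IsEtale.isLocalHomeomorph_unit (he : 𝒢.IsEtale) : IsLocalHomeomorph 𝒢.unit :=
  IsLocalHomeomorph.of_comp (g := 𝒢.r) (f := 𝒢.unit)
    (by rw [show 𝒢.r ∘ 𝒢.unit = id from funext 𝒢.r_unit]
        exact (Homeomorph.refl X).isLocalHomeomorph) he 𝒢.continuous_unit

variable (𝒢) in
/-- The set of products `g h` of composable arrows `g ∈ A` and `h ∈ B`. -/
def mulSet (A B : Set G) : Set G := {k | ∃ g ∈ A, ∃ h ∈ B, 𝒢.s g = 𝒢.r h ∧ 𝒢.mul g h = k}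

theorem isCompact_mulSet [T2Space X] {A B : Set G} (hA : IsCompact A) (hB : IsCompact B) :
    IsCompact (𝒢.mulSet A B) := by
  have h : IsCompact (A ×ˢ B ∩ {p : G × G | 𝒢.s p.1 = 𝒢.r p.2}) :=
    (hA.prod hB).inter_right (isClosed_eq (𝒢.continuous_s.comp continuous_fst)
      (𝒢.continuous_r.comp continuous_snd))
  convert h.image_of_continuousOn (𝒢.continuousOn_mul.mono Set.inter_subset_right) using 1
  ext k
  constructor
  · rintro ⟨g, hg, h, hh, hgh, rfl⟩
    exact ⟨(g, h), ⟨⟨hg, hh⟩, hgh⟩, rfl⟩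
  · rintro ⟨⟨g, h⟩, ⟨⟨hg, hh⟩, hgh⟩, rfl⟩
    exact ⟨g, hg, h, hh, hgh, rfl⟩

theorem isOpen_mulSet (he : 𝒢.IsEtale) {A B : Set G} (hA : IsOpen A) (hB : IsOpen B) :
    IsOpen (𝒢.mulSet A B) := by
  rw [isOpen_iff_mem_nhds]
  rintro _ ⟨g, hg, h, hh, hgh, rfl⟩
  -- factor the arrows `k` near `g h` through the local section of `r` at `g`
  obtain ⟨e, hge, hre⟩ := he g
  set k₀ := 𝒢.mul g h
  have hr₀ : 𝒢.r k₀ = 𝒢.r g := 𝒢.r_mul _ _ hgh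
  have hr₀' : 𝒢.r k₀ ∈ e.target := by rw [hr₀, hre]; exact e.map_source hge
  have hek₀ : e.symm (𝒢.r k₀) = g := by rw [hr₀, hre, e.left_inv hge]
  have hσ : ContinuousAt (fun k => e.symm (𝒢.r k)) k₀ :=
    ContinuousAt.comp (e.continuousAt_symm hr₀') 𝒢.continuous_r.continuousAt
  have hdom : ∀ᶠ k in 𝓝 k₀, 𝒢.r k ∈ e.target :=
    𝒢.continuous_r.continuousAt (e.open_target.mem_nhds hr₀')
  have hrσ : ∀ k, 𝒢.r k ∈ e.target → 𝒢.r (e.symm (𝒢.r k)) = 𝒢.r k := fun k hk =>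
    (congrFun hre _).trans (e.right_inv hk)
  have hcomp : ∀ k, 𝒢.r k ∈ e.target → 𝒢.s (𝒢.inv (e.symm (𝒢.r k))) = 𝒢.r k := fun k hk => by
    rw [𝒢.s_inv, hrσ k hk]
  have hτ : Filter.Tendsto (fun k => 𝒢.mul (𝒢.inv (e.symm (𝒢.r k))) k) (𝓝 k₀) (𝓝 h) := by
    have h1 := 𝒢.continuousOn_mul (𝒢.inv (e.symm (𝒢.r k₀)), k₀) (hcomp k₀ hr₀')
    have h2 : Filter.Tendsto (fun k => (𝒢.inv (e.symm (𝒢.r k)), k)) (𝓝 k₀)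
        (𝓝[{p : G × G | 𝒢.s p.1 = 𝒢.r p.2}] (𝒢.inv (e.symm (𝒢.r k₀)), k₀)) :=
      tendsto_nhdsWithin_iff.2 ⟨((𝒢.continuous_inv.continuousAt.comp hσ).prodMk_nhds
        Filter.tendsto_id), hdom.mono fun k hk => hcomp k hk⟩
    have h3 := h1.tendsto.comp h2
    rwa [hek₀, inv_mul_mul hgh] at h3
  have hσ' : Filter.Tendsto (fun k => e.symm (𝒢.r k)) (𝓝 k₀) (𝓝 g) := by
    have := hσ.tendsto
    rwa [hek₀] at this
  filter_upwards [hdom, hσ' (hA.mem_nhds hg), hτ (hB.mem_nhds hh)] with k hk hkA hkB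
  refine ⟨_, hkA, _, hkB, ?_, mul_inv_mul (hrσ k hk)⟩
  rw [𝒢.r_mul _ _ (hcomp k hk), 𝒢.r_inv]

/-- The subgroupoid generated by a compact open set `S` of arrows is compact and open if it is
relatively compact: its orbits have bounded size, so products of boundedly many elements of `S`
suffice. -/
theorem exists_isSubgroupoid [T2Space X] (he : 𝒢.IsEtale) (hp : 𝒢.IsPrincipal) {S T : Set G}
    (hSc : IsCompact S) (hSo : IsOpen S) (hinv : ∀ g ∈ S, 𝒢.inv g ∈ S)
    (hunit : ∀ g ∈ S, 𝒢.unit (𝒢.s g) ∈ S) (hT : IsCompact (closure T)) (hST : S ⊆ T)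
    (hTS : 𝒢.mulSet T S ⊆ T) :
    ∃ P, IsCompact P ∧ IsOpen P ∧ 𝒢.IsSubgroupoid P ∧ S ⊆ P ∧ P ⊆ T := by
  let Q : ℕ → Set G := fun k => (fun A => 𝒢.mulSet A S)^[k] S
  have hQ : ∀ k, Q (k + 1) = 𝒢.mulSet (Q k) S := fun k => Function.iterate_succ_apply' _ _ _
  have hQc : ∀ k, IsCompact (Q k) := fun k => by
    induction k with
    | zero => exact hSc
    | succ k ih => rw [hQ]; exact isCompact_mulSet ih hSc
  have hQo : ∀ k, IsOpen (Q k) := fun k => by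
    induction k with
    | zero => exact hSo
    | succ k ih => rw [hQ]; exact isOpen_mulSet he ih hSo
  have hQT : ∀ k, Q k ⊆ T := fun k => by
    induction k with
    | zero => exact hST
    | succ k ih =>
      rw [hQ]
      rintro _ ⟨g, hg, h, hh, hgh, rfl⟩
      exact hTS ⟨g, ih hg, h, hh, hgh, rfl⟩
  have hQs : ∀ k, ∀ g ∈ Q k, 𝒢.unit (𝒢.s g) ∈ S := fun k => by
    induction k with
    | zero => exact hunit
    | succ k ih =>
      rw [hQ]
      rintro _ ⟨g, hg, h, hh, hgh, rfl⟩
      rw [𝒢.s_mul _ _ hgh]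
      exact hunit h hh
  have hmono : Monotone Q := monotone_nat_of_le_succ fun k g hg => by
    rw [hQ]
    exact ⟨g, hg, _, hQs k g hg, (𝒢.r_unit _).symm, 𝒢.mul_unit g⟩
  -- the fibres of `r` in `Q k` grow strictly until they are stable
  obtain ⟨N, hN⟩ := he.exists_ncard_fiber_le hT
  have hsub : ∀ k x, {g ∈ Q k | 𝒢.r g = x} ⊆ {g ∈ closure T | 𝒢.r g = x} := fun k x g hg =>
    ⟨subset_closure (hQT k hg.1), hg.2⟩
  have hfin : ∀ k x, ({g ∈ Q k | 𝒢.r g = x}).Finite := fun k x => (hN x).1.subset (hsub k x)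
  have hfmono : ∀ x, Monotone fun k => {g ∈ Q k | 𝒢.r g = x} := fun x k l hkl g hg =>
    ⟨hmono hkl hg.1, hg.2⟩
  have hstep : ∀ k x, {g ∈ Q k | 𝒢.r g = x} = {g ∈ Q (k + 1) | 𝒢.r g = x} →
      {g ∈ Q (k + 1) | 𝒢.r g = x} = {g ∈ Q (k + 2) | 𝒢.r g = x} := by
    refine fun k x hk => (hfmono x (Nat.le_succ _)).antisymm ?_
    rintro g ⟨hg, rfl⟩
    rw [hQ] at hg
    obtain ⟨g, hg, h, hh, hgh, rfl⟩ := hg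
    have h1 : g ∈ {g' ∈ Q (k + 1) | 𝒢.r g' = 𝒢.r (𝒢.mul g h)} := ⟨hg, (𝒢.r_mul _ _ hgh).symm⟩
    rw [← hk] at h1
    refine ⟨?_, rfl⟩
    rw [hQ]
    exact ⟨g, h1.1, h, hh, hgh, rfl⟩
  have hstable : Q (N + 1) ⊆ Q N := by
    intro g hg
    have h1 : ∀ k, N ≤ k → ({g' ∈ Q k | 𝒢.r g' = 𝒢.r g}).ncard =
        ({g' ∈ Q N | 𝒢.r g' = 𝒢.r g}).ncard := by
      have h2 := fun n hn => Nat.stabilises_of_monotone (b := N) (n := n)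
        (f := fun k => ({g' ∈ Q k | 𝒢.r g' = 𝒢.r g}).ncard)
        (fun k l hkl => Set.ncard_le_ncard (hfmono _ hkl) (hfin _ _))
        (fun k => (Set.ncard_le_ncard (hsub k _) (hN _).1).trans (hN _).2) (fun k hk => by
          have := Set.eq_of_subset_of_ncard_le (hfmono (𝒢.r g) (Nat.le_succ k)) hk.ge (hfin _ _)
          exact congrArg Set.ncard (hstep k _ this)) hn
      exact h2
    have h3 := Set.eq_of_subset_of_ncard_le (hfmono (𝒢.r g) (Nat.le_succ N))
      (h1 (N + 1) (Nat.le_succ N)).le (hfin _ _)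
    have h4 : g ∈ {g' ∈ Q (N + 1) | 𝒢.r g' = 𝒢.r g} := ⟨hg, rfl⟩
    exact ((Set.ext_iff.1 h3 g).2 h4).1
  have hmulS : ∀ g ∈ Q N, ∀ h ∈ S, 𝒢.s g = 𝒢.r h → 𝒢.mul g h ∈ Q N := fun g hg h hh hgh =>
    hstable (by rw [hQ]; exact ⟨g, hg, h, hh, hgh, rfl⟩)
  have hmulQ : ∀ k, ∀ g ∈ Q N, ∀ h ∈ Q k, 𝒢.s g = 𝒢.r h → 𝒢.mul g h ∈ Q N := by
    intro k
    induction k with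
    | zero => exact hmulS
    | succ k ih =>
      intro g hg h hh hgh
      rw [hQ] at hh
      obtain ⟨h, hh, h', hh', hhh, rfl⟩ := hh
      rw [𝒢.r_mul _ _ hhh] at hgh
      rw [← 𝒢.mul_assoc _ _ _ hgh hhh]
      exact hmulS _ (ih g hg h hh hgh) h' hh' (by rw [𝒢.s_mul _ _ hgh, hhh])
  have hSQ : S ⊆ Q N := hmono (Nat.zero_le N)
  have hinvQ : ∀ k, ∀ g ∈ Q k, 𝒢.inv g ∈ Q N := by
    intro k
    induction k with
    | zero => exact fun g hg => hSQ (hinv g hg)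
    | succ k ih =>
      intro g hg
      rw [hQ] at hg
      obtain ⟨g, hg, h, hh, hgh, rfl⟩ := hg
      rw [inv_mul_rev hp hgh]
      exact hmulQ N _ (hSQ (hinv h hh)) _ (ih g hg) (by rw [𝒢.s_inv, 𝒢.r_inv, hgh])
  exact ⟨Q N, hQc N, hQo N, ⟨hinvQ N, hmulQ N⟩, hSQ, hQT N⟩

/-- A compact open principal subgroupoid `P` has a fundamental domain: each object can be moved
continuously, by arrows in `P` (or identities outside of `P`), to a point of its `P`-orbit that
depends only on the orbit. -/
theorem exists_rangeSection_of_isSubgroupoid [T2Space X] [T2Space G] (he : 𝒢.IsEtale)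
    (hp : 𝒢.IsPrincipal) (hX : ∀ (x : X) (U : Set X), IsOpen U → x ∈ U →
      ∃ V, IsCompact V ∧ IsOpen V ∧ x ∈ V ∧ V ⊆ U)
    {P : Set G} (hPc : IsCompact P) (hPo : IsOpen P) (hP : 𝒢.IsSubgroupoid P) :
    ∃ γ : 𝒢.RangeSection (id : X → X), (∀ g ∈ P, γ.vertex (𝒢.r g) = γ.vertex (𝒢.s g)) ∧
      ∀ x, γ.arrow x ∈ P ∨ γ.arrow x = 𝒢.unit x := by
  classical
  -- by compactness, no arrow in `P` but identities joins two points of a small open set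
  have hD : IsCompact (P \ Set.range 𝒢.unit) :=
    hPc.diff he.isLocalHomeomorph_unit.isOpenMap.isOpen_range
  have hDc : IsClosed ((fun g => (𝒢.r g, 𝒢.s g)) '' (P \ Set.range 𝒢.unit)) :=
    (hD.image (𝒢.continuous_r.prodMk 𝒢.continuous_s)).isClosed
  have hW : ∀ x : X, ∃ W : Set X, IsOpen W ∧ x ∈ W ∧
      ∀ g ∈ P, 𝒢.r g ∈ W → 𝒢.s g ∈ W → g ∈ Set.range 𝒢.unit := by
    intro x
    have hx : (x, x) ∉ (fun g => (𝒢.r g, 𝒢.s g)) '' (P \ Set.range 𝒢.unit) := by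
      rintro ⟨g, ⟨-, hg⟩, hgx⟩
      rw [Prod.mk.injEq] at hgx
      exact hg ⟨_, (hp g (hgx.1.trans hgx.2.symm)).symm⟩
    have hn := hDc.isOpen_compl.mem_nhds hx
    rw [nhds_prod_eq, Filter.mem_prod_self_iff] at hn
    obtain ⟨W, hW, hWW⟩ := hn
    obtain ⟨W', hW', hWo, hxW⟩ := mem_nhds_iff.1 hW
    refine ⟨W', hWo, hxW, fun g hg hr hs => ?_⟩
    by_contra hcon
    exact hWW (Set.mk_mem_prod (hW' hr) (hW' hs)) ⟨g, ⟨hg, hcon⟩, rfl⟩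
  choose W hWo hxW hW using hW
  have : IsCompact (𝒢.r '' P) := hPc.image 𝒢.continuous_r
  have hMclosed := this.isClosed
  have hPs : ∀ g ∈ P, 𝒢.s g ∈ 𝒢.r '' P := fun g hg => ⟨_, hP.1 g hg, 𝒢.r_inv g⟩
  rcases isEmpty_or_nonempty X with hXe | hXne
  · exact ⟨⟨𝒢.unit, 𝒢.continuous_unit, 𝒢.r_unit⟩, fun g => (hXe.false (𝒢.r g)).elim,
      fun x => Or.inr rfl⟩
  obtain ⟨l, hl, hlW⟩ := this.exists_isLocallyConstant_mem hX hWo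
    fun x _ => Set.mem_iUnion.2 ⟨x, hxW x⟩
  -- labels separate the points of an orbit
  have huniq : ∀ g ∈ P, ∀ h ∈ P, 𝒢.r g = 𝒢.r h → l (𝒢.s g) = l (𝒢.s h) → g = h := by
    intro g hg h hh hgh hlab
    have hc : 𝒢.s (𝒢.inv g) = 𝒢.r h := by rw [𝒢.s_inv, hgh]
    have hk : 𝒢.mul (𝒢.inv g) h ∈ P := hP.2 _ (hP.1 g hg) h hh hc
    obtain ⟨x, hx⟩ := hW (l (𝒢.s g)) _ hk
      (by rw [𝒢.r_mul _ _ hc, 𝒢.r_inv]; exact hlW _ (hPs g hg))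
      (by rw [𝒢.s_mul _ _ hc, hlab]; exact hlW _ (hPs h hh))
    have h1 := congrArg 𝒢.r hx
    have h2 := congrArg 𝒢.s hx
    rw [𝒢.r_unit, 𝒢.r_mul _ _ hc, 𝒢.r_inv] at h1
    rw [𝒢.s_unit, 𝒢.s_mul _ _ hc] at h2
    exact hp.eq_of_r_eq_of_s_eq hgh (h1.symm.trans h2)
  -- the representative of an orbit is its point with the smallest label, for some well-order
  obtain ⟨_, _⟩ := exists_wellFoundedLT X
  have : Nonempty G := hXne.map 𝒢.unit
  have hmin : ∀ x ∈ 𝒢.r '' P, ∃ g ∈ P, 𝒢.r g = x ∧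
      ∀ h ∈ P, 𝒢.r h = x → l (𝒢.s g) ≤ l (𝒢.s h) := by
    rintro x ⟨g, hg, hgx⟩
    obtain ⟨_, ⟨g', ⟨hg', hgx'⟩, rfl⟩, hmin⟩ := (wellFounded_lt (α := X)).has_min
      ((fun g => l (𝒢.s g)) '' {g ∈ P | 𝒢.r g = x}) ⟨_, g, ⟨hg, hgx⟩, rfl⟩
    exact ⟨g', hg', hgx', fun h hh hhx => not_lt.1 (hmin _ ⟨h, ⟨hh, hhx⟩, rfl⟩)⟩
  choose! a haP har hamin using hmin
  let γ : X → G := fun x => if x ∈ 𝒢.r '' P then a x else 𝒢.unit x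
  have hγ : ∀ x ∈ 𝒢.r '' P, γ x = a x := fun x hx => if_pos hx
  have hγ' : ∀ x ∉ 𝒢.r '' P, γ x = 𝒢.unit x := fun x hx => if_neg hx
  have hcont : Continuous γ := by
    rw [continuous_iff_continuousAt]
    intro x
    by_cases hx : x ∈ 𝒢.r '' P
    · have hax := haP x hx
      obtain ⟨e, hae, hre⟩ := he (a x)
      have hxe : x ∈ e.target := by
        have := e.map_source hae
        rwa [← hre, har x hx] at this
      have hex : e.symm x = a x := by
        conv_lhs => rw [← har x hx, hre]
        exact e.left_inv hae
      have hσ : Filter.Tendsto e.symm (𝓝 x) (𝓝 (a x)) := by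
        have := (e.continuousAt_symm hxe).tendsto
        rwa [hex] at this
      -- near `x` no arrow in `P` has a label smaller than that of `a x`
      have hB : IsCompact (P ∩ {h | l (𝒢.s h) < l (𝒢.s (a x))}) :=
        hPc.inter_right ((hl.isClopen_preimage (Set.Iio _)).isClosed.preimage 𝒢.continuous_s)
      have hxB : x ∉ 𝒢.r '' (P ∩ {h | l (𝒢.s h) < l (𝒢.s (a x))}) := by
        rintro ⟨h, ⟨hh, hlt⟩, hhx⟩
        exact (hamin x hx h hh hhx).not_gt hlt
      have hBc := (hB.image 𝒢.continuous_r).isClosed.isOpen_compl.mem_nhds hxB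
      have hlab : ∀ᶠ g in 𝓝 (a x), l (𝒢.s g) = l (𝒢.s (a x)) :=
        𝒢.continuous_s.continuousAt.eventually (hl.eventually_eq (𝒢.s (a x)))
      have heq : ∀ᶠ y in 𝓝 x, e.symm y = γ y := by
        filter_upwards [hσ (hPo.mem_nhds hax), hσ hlab, hBc, e.open_target.mem_nhds hxe]
          with y hyP hyl hyB hye
        have hry : 𝒢.r (e.symm y) = y := (congrFun hre _).trans (e.right_inv hye)
        have hy : y ∈ 𝒢.r '' P := ⟨_, hyP, hry⟩
        rw [hγ y hy]
        refine huniq _ hyP _ (haP y hy) (hry.trans (har y hy).symm) (le_antisymm ?_ ?_)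
        · refine le_of_eq_of_le hyl (not_lt.1 fun hlt => hyB ⟨_, ⟨haP y hy, hlt⟩, har y hy⟩)
        · exact hamin y hy _ hyP hry
      rw [ContinuousAt, hγ x hx]
      exact hσ.congr' heq
    · refine 𝒢.continuous_unit.continuousAt.congr ?_
      filter_upwards [hMclosed.isOpen_compl.mem_nhds hx] with y hy
      exact (hγ' y hy).symm
  refine ⟨⟨γ, hcont, fun x => ?_⟩, fun g hg => ?_, fun x => ?_⟩
  · by_cases hx : x ∈ 𝒢.r '' P
    · rw [hγ x hx, har x hx, id]
    · rw [hγ' x hx, 𝒢.r_unit, id]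
  · have hr : 𝒢.r g ∈ 𝒢.r '' P := ⟨g, hg, rfl⟩
    have hs := hPs g hg
    change 𝒢.s (γ (𝒢.r g)) = 𝒢.s (γ (𝒢.s g))
    rw [hγ _ hr, hγ _ hs]
    have hc : 𝒢.s g = 𝒢.r (a (𝒢.s g)) := (har _ hs).symm
    have hc' : 𝒢.s (𝒢.inv g) = 𝒢.r (a (𝒢.r g)) := by rw [𝒢.s_inv, har _ hr]
    have h1 : 𝒢.mul g (a (𝒢.s g)) ∈ P := hP.2 _ hg _ (haP _ hs) hc
    have h2 : 𝒢.mul (𝒢.inv g) (a (𝒢.r g)) ∈ P := hP.2 _ (hP.1 _ hg) _ (haP _ hr) hc'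
    have h3 := hamin _ hr _ h1 (𝒢.r_mul _ _ hc)
    have h4 := hamin _ hs _ h2 (by rw [𝒢.r_mul _ _ hc', 𝒢.r_inv])
    rw [𝒢.s_mul _ _ hc] at h3
    rw [𝒢.s_mul _ _ hc'] at h4
    rw [huniq _ (haP _ hr) _ h1 (by rw [har _ hr, 𝒢.r_mul _ _ hc])
      (by rw [𝒢.s_mul _ _ hc]; exact h3.antisymm h4), 𝒢.s_mul _ _ hc]
  · by_cases hx : x ∈ 𝒢.r '' P
    · exact Or.inl (show γ x ∈ P by rw [hγ x hx]; exact haP x hx)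
    · exact Or.inr (hγ' x hx)

theorem IsAmple.exists_isCompact_isOpen_subset (hample : 𝒢.IsAmple) (x : X) (U : Set X)
    (hU : IsOpen U) (hx : x ∈ U) : ∃ V, IsCompact V ∧ IsOpen V ∧ x ∈ V ∧ V ⊆ U := by
  obtain ⟨B, ⟨hBc, hBo, -⟩, hxB, hBU⟩ := hample.isTopologicalBasis.exists_subset_of_mem_open
    (a := 𝒢.unit x) (u := 𝒢.r ⁻¹' U) (by simpa [𝒢.r_unit] using hx)
    (hU.preimage 𝒢.continuous_r)
  exact ⟨𝒢.r '' B, hBc.image 𝒢.continuous_r, hample.isEtale.isOpenMap _ hBo,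
    ⟨_, hxB, 𝒢.r_unit x⟩, Set.image_subset_iff.2 hBU⟩

theorem IsAmple.exists_isCompact_isOpen_superset (hample : 𝒢.IsAmple) {K : Set G}
    (hK : IsCompact K) : ∃ B, IsCompact B ∧ IsOpen B ∧ K ⊆ B := by
  refine hK.induction_on (p := fun K => ∃ B, IsCompact B ∧ IsOpen B ∧ K ⊆ B)
    ⟨∅, isCompact_empty, isOpen_empty, subset_rfl⟩ ?_ ?_ ?_
  · rintro s t hst ⟨B, h1, h2, h3⟩
    exact ⟨B, h1, h2, hst.trans h3⟩
  · rintro s t ⟨B, h1, h2, h3⟩ ⟨C, h4, h5, h6⟩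
    exact ⟨B ∪ C, h1.union h4, h2.union h5, Set.union_subset_union h3 h6⟩
  · intro g _
    obtain ⟨B, ⟨hBc, hBo, -⟩, hgB, -⟩ := hample.isTopologicalBasis.exists_subset_of_mem_open
      (Set.mem_univ g) isOpen_univ
    exact ⟨B, mem_nhdsWithin_of_mem_nhds (hBo.mem_nhds hgB), B, hBc, hBo, subset_rfl⟩

/-- Dynamic asymptotic dimension at most `d` provides, for a compact set `K` of arrows, `d + 1`
colours of the objects and a collapse `γ` along arrows such that the ends of an arrow in `K` are
collapsed to the same point or to points of different colours. -/
theorem exists_rangeSection_of_dynamicAsymptoticDimensionLE [T2Space X] [T2Space G]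
    (hample : 𝒢.IsAmple) (hp : 𝒢.IsPrincipal) {d : ℕ} (hdad : 𝒢.DynamicAsymptoticDimensionLE d)
    {K : Set G} (hK : IsCompact K) :
    ∃ (c : X → Fin (d + 1)) (γ : 𝒢.RangeSection (id : X → X)), IsLocallyConstant c ∧
      ∀ g ∈ K, c (γ.vertex (𝒢.r g)) = c (γ.vertex (𝒢.s g)) →
        γ.vertex (𝒢.r g) = γ.vertex (𝒢.s g) := by
  have he := hample.isEtale
  have hX := hample.exists_isCompact_isOpen_subset
  obtain ⟨B, hBc, hBo, hKB⟩ := hample.exists_isCompact_isOpen_superset hK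
  -- a compact open set of arrows containing `K`, symmetric and containing identities
  let E : Set G := B ∪ 𝒢.inv ⁻¹' B
  have hE : ∀ g ∈ E, 𝒢.inv g ∈ E := by
    rintro g (hg | hg)
    · exact Or.inr (by rwa [Set.mem_preimage, 𝒢.inv_inv])
    · exact Or.inl hg
  have hEo : IsOpen E := hBo.union (hBo.preimage 𝒢.continuous_inv)
  have hEc : IsCompact E := by
    refine hBc.union ?_
    convert hBc.image 𝒢.continuous_inv using 1
    ext g
    constructor
    · exact fun hg => ⟨_, hg, 𝒢.inv_inv g⟩
    · rintro ⟨h, hh, rfl⟩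
      rwa [Set.mem_preimage, 𝒢.inv_inv]
  let F : Set G := E ∪ 𝒢.unit '' (𝒢.s '' E)
  have hFo : IsOpen F := hEo.union
    (he.isLocalHomeomorph_unit.isOpenMap _ (he.isLocalHomeomorph_s.isOpenMap _ hEo))
  have hFc : IsCompact F :=
    hEc.union ((hEc.image 𝒢.continuous_s).image 𝒢.continuous_unit)
  have hFinv : ∀ g ∈ F, 𝒢.inv g ∈ F := by
    rintro g (hg | ⟨x, hx, rfl⟩)
    · exact Or.inl (hE g hg)
    · exact Or.inr ⟨x, hx, (inv_unit hp x).symm⟩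
  have hFunit : ∀ g ∈ F, 𝒢.unit (𝒢.s g) ∈ F := by
    rintro g (hg | ⟨x, hx, rfl⟩)
    · exact Or.inr ⟨_, ⟨g, hg, rfl⟩, rfl⟩
    · rw [𝒢.s_unit]
      exact Or.inr ⟨x, hx, rfl⟩
  obtain ⟨U, hUo, hUcov, hUH⟩ := hdad F hFo (by rwa [hFc.isClosed.closure_eq])
  choose H hH hHc hUH using hUH
  obtain ⟨c, hc, hcU⟩ := ((hFc.image 𝒢.continuous_r).union
    (hFc.image 𝒢.continuous_s)).exists_isLocallyConstant_mem hX hUo hUcov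
  -- the monochromatic arrows generate a compact open subgroupoid
  have hmono : IsClopen {g | c (𝒢.r g) = c (𝒢.s g)} := by
    have := ((hc.comp_continuous 𝒢.continuous_r).prodMk (hc.comp_continuous 𝒢.continuous_s))
    exact this.isClopen_preimage {p : Fin (d + 1) × Fin (d + 1) | p.1 = p.2}
  let T : Set G := {g | c (𝒢.r g) = c (𝒢.s g) ∧ g ∈ H (c (𝒢.s g))}
  have hFH : ∀ g ∈ F, c (𝒢.r g) = c (𝒢.s g) → g ∈ H (c (𝒢.s g)) := by
    intro g hg hcg
    refine hUH _ ⟨hg, hcU _ (Or.inr ⟨g, hg, rfl⟩), ?_⟩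
    have := hcU (𝒢.r g) (Or.inl ⟨g, hg, rfl⟩)
    rwa [hcg] at this
  obtain ⟨P, hPc, hPo, hP, hFP, hPT⟩ := exists_isSubgroupoid he hp
    (S := F ∩ {g | c (𝒢.r g) = c (𝒢.s g)}) (T := T) (hFc.inter_right hmono.isClosed)
    (hFo.inter hmono.isOpen)
    (fun g hg => ⟨hFinv g hg.1, by
      rw [Set.mem_ofPred_eq, 𝒢.r_inv, 𝒢.s_inv]; exact hg.2.symm⟩)
    (fun g hg => ⟨hFunit g hg.1, by rw [Set.mem_ofPred_eq, 𝒢.r_unit, 𝒢.s_unit]⟩)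
    ((isCompact_iUnion hHc).of_isClosed_subset isClosed_closure (by
      rw [← closure_iUnion_of_finite]
      exact closure_mono fun g hg => Set.mem_iUnion.2 ⟨_, hg.2⟩))
    (fun g hg => ⟨hg.2, hFH g hg.1 hg.2⟩) (by
      rintro _ ⟨g, ⟨hg1, hg2⟩, h, ⟨hh1, hh2⟩, hgh, rfl⟩
      have h1 := hFH h hh1 hh2
      rw [Set.mem_ofPred_eq] at hh2
      rw [Set.mem_ofPred_eq, 𝒢.r_mul _ _ hgh, 𝒢.s_mul _ _ hgh]
      refine ⟨by rw [hg1, hgh, hh2], (hH _).2 g ?_ h h1 hgh⟩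
      rwa [hgh, hh2] at hg2)
  obtain ⟨γ, hγ, hγP⟩ := exists_rangeSection_of_isSubgroupoid he hp hX hPc hPo hP
  have hcγ : ∀ x, c (γ.vertex x) = c x := by
    intro x
    rcases hγP x with h | h
    · have h1 := (hPT h).1
      rw [γ.r_arrow] at h1
      exact h1.symm
    · rw [RangeSection.vertex, h, 𝒢.s_unit]
  refine ⟨c, γ, hc, fun g hg hcg => hγ g (hFP ⟨Or.inl (Or.inl (hKB hg)), ?_⟩)⟩
  rwa [hcγ, hcγ] at hcg

end TopologicalGroupoid

/-! ### Homology of groupoids of finite dynamic asymptotic dimension -/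

namespace TopologicalGroupoid

open OrderedChain

variable {X G : Type*} [TopologicalSpace X] [TopologicalSpace G]
  {𝒢 : TopologicalGroupoid X G}

/-- The arrows between the objects of the strings in `S`. -/
def connecting {n : ℕ} (S : Set (𝒢.BG n)) : Set G :=
  ⋃ (i : Fin (n + 1)) (j : Fin (n + 1)), (BG.section n i).between (BG.section n j) '' S

theorem isCompact_connecting {n : ℕ} {S : Set (𝒢.BG n)} (hS : IsCompact S) :
    IsCompact (connecting S) :=
  isCompact_iUnion fun _ => isCompact_iUnion fun _ =>
    hS.image (RangeSection.continuous_between _ _)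

theorem compatible_objs {ι : Type*} {c : X → ι} {f : X → X} {n : ℕ} {S : Set (𝒢.BG n)}
    {K : Set G} (hSK : connecting S ⊆ K)
    (hK : ∀ g ∈ K, c (f (𝒢.r g)) = c (f (𝒢.s g)) → f (𝒢.r g) = f (𝒢.s g)) {p : 𝒢.BG n}
    (hpS : p ∈ S) : Compatible c f p.objs := by
  intro y hy z hz
  obtain ⟨i, rfl⟩ := (List.mem_ofFn' _ _).1 hy
  obtain ⟨j, rfl⟩ := (List.mem_ofFn' _ _).1 hz
  have h := hK ((BG.section n i).between (BG.section n j) p)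
    (hSK (Set.mem_iUnion₂.2 ⟨i, j, p, hpS, rfl⟩))
  rwa [RangeSection.r_between, RangeSection.s_between, BG.vertex_section, BG.vertex_section] at h

variable [T2Space X] [T2Space G]

theorem exists_boundary_eq_of_lt (hample : 𝒢.IsAmple) (hp : 𝒢.IsPrincipal) {d n : ℕ}
    (hdad : 𝒢.DynamicAsymptoticDimensionLE d) (hn : d < n) {a : C_c(𝒢.BG n, ℤ)}
    (ha : 𝒢.IsCycle hample.isEtale a) : ∃ b, 𝒢.boundary hample.isEtale n b = a := by
  obtain ⟨c, γ, hc, hK⟩ := exists_rangeSection_of_dynamicAsymptoticDimensionLE hample hp hdad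
    (isCompact_connecting a.hasCompactSupport.isCompact)
  exact exists_boundary_eq hample.isEtale hp hc γ (by simpa using hn) ha fun p hpa =>
    compatible_objs subset_rfl hK (subset_tsupport _ hpa)

theorem exists_boundary_eq_of_boundary_eq_nsmul (hample : 𝒢.IsAmple) (hp : 𝒢.IsPrincipal) {d : ℕ}
    (hdad : 𝒢.DynamicAsymptoticDimensionLE d) {a : C_c(𝒢.BG d, ℤ)}
    (ha : 𝒢.IsCycle hample.isEtale a) {m : ℕ} (hm : m ≠ 0) {b : C_c(𝒢.BG (d + 1), ℤ)}
    (hb : 𝒢.boundary hample.isEtale d b = m • a) : ∃ b, 𝒢.boundary hample.isEtale d b = a := by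
  obtain ⟨c, γ, hc, hK⟩ := exists_rangeSection_of_dynamicAsymptoticDimensionLE hample hp hdad
    ((isCompact_connecting a.hasCompactSupport.isCompact).union
      (isCompact_connecting b.hasCompactSupport.isCompact))
  exact exists_boundary_eq_of_nsmul hample.isEtale hp hc γ (by simp) ha
    (fun p hpa => compatible_objs Set.subset_union_left hK (subset_tsupport _ hpa)) hm hb
    fun p hpb => compatible_objs Set.subset_union_right hK (subset_tsupport _ hpb)

open CategoryTheory

theorem chainComplex_d (he : 𝒢.IsEtale) (n : ℕ) :
    (𝒢.chainComplex he).d (n + 1) n = AddCommGrpCat.ofHom (𝒢.boundary he n) :=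
  ChainComplex.of_d (fun n => AddCommGrpCat.of C_c(𝒢.BG n, ℤ))
    (fun n => AddCommGrpCat.ofHom (𝒢.boundary he n)) n

theorem isCycle_iCycles (he : 𝒢.IsEtale) {n : ℕ} (z : (𝒢.chainComplex he).cycles n) :
    𝒢.IsCycle he ((𝒢.chainComplex he).iCycles n z : C_c(𝒢.BG n, ℤ)) := by
  cases n with
  | zero => trivial
  | succ n =>
    have h := ConcreteCategory.congr_hom ((𝒢.chainComplex he).iCycles_d (n + 1) n) z
    rw [chainComplex_d] at h
    exact h

theorem homologyπ_surjective (he : 𝒢.IsEtale) (n : ℕ) :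
    Function.Surjective ((𝒢.chainComplex he).homologyπ n) :=
  (AddCommGrpCat.epi_iff_surjective _).1 inferInstance

theorem homologyπ_eq_zero_iff (he : 𝒢.IsEtale) {n : ℕ} (z : (𝒢.chainComplex he).cycles n) :
    (𝒢.chainComplex he).homologyπ n z = 0 ↔
      ∃ b, 𝒢.boundary he n b = ((𝒢.chainComplex he).iCycles n z : C_c(𝒢.BG n, ℤ)) := by
  have hex : (ShortComplex.mk _ _ ((𝒢.chainComplex he).toCycles_comp_homologyπ (n + 1) n)).Exact :=
    ShortComplex.exact_of_g_is_cokernel _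
      ((𝒢.chainComplex he).homologyIsCokernel (n + 1) n (ChainComplex.prev ℕ n))
  rw [ShortComplex.ab_exact_iff_function_exact] at hex
  refine (hex z).trans ⟨?_, ?_⟩
  · rintro ⟨b, rfl⟩
    have h := ConcreteCategory.congr_hom ((𝒢.chainComplex he).toCycles_i (n + 1) n) b
    rw [chainComplex_d] at h
    exact ⟨b, h.symm⟩
  · rintro ⟨b, hb⟩
    refine ⟨b, (AddCommGrpCat.mono_iff_injective ((𝒢.chainComplex he).iCycles n)).1
      inferInstance ?_⟩
    have h := ConcreteCategory.congr_hom ((𝒢.chainComplex he).toCycles_i (n + 1) n) b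
    rw [chainComplex_d] at h
    exact h.trans hb

end TopologicalGroupoid

theorem theoremA {X G : Type*} [TopologicalSpace X] [TopologicalSpace G]
    [T2Space X] [LocallyCompactSpace X] [T2Space G] [LocallyCompactSpace G] [SigmaCompactSpace G]
    (𝒢 : TopologicalGroupoid X G) (hample : 𝒢.IsAmple) (hprincipal : 𝒢.IsPrincipal)
    (d : ℕ) (hdad : 𝒢.DynamicAsymptoticDimensionLE d) :
    (∀ n : ℕ, d < n → Subsingleton (𝒢.homology hample.isEtale n)) ∧
      IsAddTorsionFree (𝒢.homology hample.isEtale d) := by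
  have he := hample.isEtale
  constructor
  · intro n hn
    refine subsingleton_of_forall_eq 0 fun x => ?_
    obtain ⟨z, rfl⟩ := TopologicalGroupoid.homologyπ_surjective he n x
    exact (TopologicalGroupoid.homologyπ_eq_zero_iff he z).2
      (TopologicalGroupoid.exists_boundary_eq_of_lt hample hprincipal hdad hn
        (TopologicalGroupoid.isCycle_iCycles he z))
  · have htors : ∀ m : ℕ, m ≠ 0 → ∀ x : 𝒢.homology he d, m • x = 0 → x = 0 := by
      intro m hm x hx
      obtain ⟨z, rfl⟩ := TopologicalGroupoid.homologyπ_surjective he d x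
      have hmz : (𝒢.chainComplex he).homologyπ d (m • z) = 0 := (map_nsmul _ m z).trans hx
      obtain ⟨b, hb⟩ := (TopologicalGroupoid.homologyπ_eq_zero_iff he _).1 hmz
      exact (TopologicalGroupoid.homologyπ_eq_zero_iff he z).2
        (TopologicalGroupoid.exists_boundary_eq_of_boundary_eq_nsmul hample hprincipal hdad
          (TopologicalGroupoid.isCycle_iCycles he z) hm (hb.trans (map_nsmul _ m z)))
    refine ⟨fun m hm x y hxy => sub_eq_zero.1 (htors m hm _ ?_)⟩
    rw [nsmul_sub]
    exact sub_eq_zero.2 hxy
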